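/- **Setting.** For positive integers $\ell,m,k$, the $\ell\times m\times k$ Rubik's Cube consists of $\ell m k$ cubies at the positions $(x,y,z)$ with $0\le x<\ell$, $0\le y<m$, $0\le z<k$. A *configuration* assigns one of six colors to each visible face of each cubie. It is *solved* if each of the six sides of the cube has a single color and different sides have different colors. A *slice* is the set of cubies that match in one given coordinate. A legal *move* rotates one slice around its perpendicular: by $90^\circ$ in either direction if the slice is square, and by $180^\circ$ otherwise; if a dimension has length $1$, the only slice in that dimension may not be rotated. A *solution* of a configuration is a sequence of legal moves that leads from it to a solved configuration; it is *optimal* if no solution has fewer moves. For the $c_1\times c_2\times n$ cube, a move is *short* if it rotates a slice $z=\text{const}$ and *long* otherwise, and cubie cluster $i$ ($0\le i<n$) is the union of the slices $z=i$ and $z=n-1-i$. **Theorem.** Let $c_1,c_2\ge 1$ be fixed integers. 1. There are constants $B$ and $B'$, depending only on $c_1$ and $c_2$, such that for every $n\ge 1$ with $c_1\ne n\ne c_2$ and every configuration of the $c_1\times c_2\times n$ Rubik's Cube, every optimal solution of the configuration contains, for each cubie cluster, at most $B$ short moves that rotate a slice of this cluster, and contains at most $B'$ long moves in total. 2. An optimal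 solution can be computed in time polynomial in $n$: there are a (multi-stack) Turing machine and a polynomial $p$, both depending only on $c_1$ and $c_2$, such that for every $n\ge 1$ with $c_1\ne n\ne c_2$ and every configuration of the $c_1\times c_2\times n$ Rubik's Cube, the machine, given the list of the colors of the visible faces, halts after at most $p(n)$ steps and outputs an optimal solution (the list of its moves) if the configuration has a solution, and reports that there is none otherwise. -/

import Mathlib

namespace RubikCube

/-- The six colors. -/
abbrev Color : Type := Fin 6

/-- A visible face of a cubie of the `d 0 × d 1 × d 2` Rubik's Cube: the cubie's position, together
with the outward normal of the face, which is the positive (`positive = true`) or the negative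
direction of the coordinate axis `axis`. -/
@[ext]
structure Facelet (d : Fin 3 → ℕ) where
  pos : Fin 3 → ℕ
  axis : Fin 3
  positive : Bool
  pos_lt : ∀ a, pos a < d a
  visible : pos axis = if positive then d axis - 1 else 0

/-- A configuration maps each visible face of each cubie to a color. -/
abbrev Config (d : Fin 3 → ℕ) : Type := Facelet d → Color

/-- Each of the six sides has a single color, and different sides have different colors. -/
def Solved {d : Fin 3 → ℕ} (C : Config d) : Prop :=
  ∃ side : Fin 3 × Bool → Color, Function.Injective side ∧
    ∀ f : Facelet d, C f = side (f.axis, f.positive)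

/-- Rotations of a slice around its perpendicular: by 90° in either direction, or by 180°. -/
inductive Turn
  | ccw
  | cw
  | half
  deriving DecidableEq

/-- The opposite rotation. -/
def Turn.inverse : Turn → Turn
  | ccw => cw
  | cw => ccw
  | half => half

/-- A legal move: rotate the slice of all cubies whose coordinate `axis` equals `index`.
A square slice is rotated by 90° in either direction, any other slice by 180°; the only slice
in a dimension of length 1 is not rotated. -/
structure Move (d : Fin 3 → ℕ) where
  axis : Fin 3
  index : ℕ
  turn : Turn
  index_lt : index < d axis
  length_ne_one : d axis ≠ 1
  turn_legal : turn = Turn.half ↔ d (axis + 1) ≠ d (axis + 2)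

/-- The move that undoes `m`. -/
def Move.inverse {d : Fin 3 → ℕ} (m : Move d) : Move d where
  axis := m.axis
  index := m.index
  turn := m.turn.inverse
  index_lt := m.index_lt
  length_ne_one := m.length_ne_one
  turn_legal := by
    rw [← m.turn_legal]
    cases m.turn <;> simp [Turn.inverse]

/-- Rotation of positions around the center line of the cube parallel to axis `a`. With
`u = a + 1` and `v = a + 2` (a right-handed frame together with `a`), the counterclockwise quarter
turn sends the direction `u` to `v` and `v` to `-u`. -/
def rotatePos (d : Fin 3 → ℕ) (a : Fin 3) (t : Turn) (p : Fin 3 → ℕ) : Fin 3 → ℕ := fun e =>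
  if e = a then p e
  else match t with
    | Turn.half => d e - 1 - p e
    | Turn.ccw => if e = a + 1 then d e - 1 - p (a + 2) else p (a + 1)
    | Turn.cw => if e = a + 1 then p (a + 2) else d e - 1 - p (a + 1)

/-- The axis of the rotated normal. -/
def rotateAxis (a : Fin 3) (t : Turn) (e : Fin 3) : Fin 3 :=
  if e = a ∨ t = Turn.half then e
  else if e = a + 1 then a + 2 else a + 1

/-- The sign of the rotated normal. -/
def rotateSign (a : Fin 3) (t : Turn) (e : Fin 3) (s : Bool) : Bool :=
  match t with
  | Turn.half => if e = a then s else !s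
  | Turn.ccw => if e = a + 2 then !s else s
  | Turn.cw => if e = a + 1 then !s else s

theorem fin3_cases (a : Fin 3) : a = 0 ∨ a = 1 ∨ a = 2 := by
  revert a; decide

theorem rotatePos_lt {d : Fin 3 → ℕ} (m : Move d) {p : Fin 3 → ℕ} (hp : ∀ a, p a < d a)
    (e : Fin 3) : rotatePos d m.axis m.turn p e < d e := by
  have ht := m.turn_legal
  have h0 := hp 0
  have h1 := hp 1
  have h2 := hp 2
  generalize m.axis = a at *
  generalize m.turn = t at *
  clear hp m
  rcases fin3_cases a with rfl | rfl | rfl <;> rcases fin3_cases e with rfl | rfl | rfl <;>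
    cases t <;> simp [rotatePos] at ht ⊢ <;> omega

theorem rotatePos_visible {d : Fin 3 → ℕ} (m : Move d) (f : Facelet d) :
    rotatePos d m.axis m.turn f.pos (rotateAxis m.axis m.turn f.axis) =
      if rotateSign m.axis m.turn f.axis f.positive then
        d (rotateAxis m.axis m.turn f.axis) - 1 else 0 := by
  have ht := m.turn_legal
  obtain ⟨p, e, s, hp, hv⟩ := f
  have h0 := hp 0
  have h1 := hp 1
  have h2 := hp 2
  generalize m.axis = a at *
  generalize m.turn = t at *
  change rotatePos d a t p (rotateAxis a t e) =
    if rotateSign a t e s then d (rotateAxis a t e) - 1 else 0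
  clear hp m
  rcases fin3_cases a with rfl | rfl | rfl <;> rcases fin3_cases e with rfl | rfl | rfl <;>
    cases t <;> cases s <;> simp [rotatePos, rotateAxis, rotateSign] at ht hv ⊢ <;> omega

/-- Where the move `m` takes the visible face `f`. -/
def Facelet.rotate {d : Fin 3 → ℕ} (m : Move d) (f : Facelet d) : Facelet d :=
  if f.pos m.axis = m.index then
    { pos := rotatePos d m.axis m.turn f.pos
      axis := rotateAxis m.axis m.turn f.axis
      positive := rotateSign m.axis m.turn f.axis f.positive
      pos_lt := rotatePos_lt m f.pos_lt
      visible := rotatePos_visible m f }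
  else f

/-- The configuration after the move `m`; see `applyMove_rotate`. -/
def applyMove {d : Fin 3 → ℕ} (C : Config d) (m : Move d) : Config d :=
  fun f => C (f.rotate m.inverse)

theorem rotate_rotate_inverse {d : Fin 3 → ℕ} (m : Move d) (f : Facelet d) :
    (f.rotate m).rotate m.inverse = f := by
  by_cases h : f.pos m.axis = m.index
  · have h' : rotatePos d m.axis m.turn f.pos m.axis = m.index := by simp [rotatePos, h]
    have ht := m.turn_legal
    simp only [Facelet.rotate, h, Move.inverse, if_true, h']
    obtain ⟨p, e, s, hp, hv⟩ := f
    have h0 := hp 0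
    have h1 := hp 1
    have h2 := hp 2
    rw [Facelet.ext_iff]
    dsimp only
    clear hv h h' hp
    generalize m.axis = a at *
    generalize m.turn = t at *
    refine ⟨funext fun b => ?_, ?_, ?_⟩
    · rcases fin3_cases a with rfl | rfl | rfl <;> rcases fin3_cases b with rfl | rfl | rfl <;>
        cases t <;> simp [rotatePos, Turn.inverse] at ht ⊢ <;> omega
    · rcases fin3_cases a with rfl | rfl | rfl <;> rcases fin3_cases e with rfl | rfl | rfl <;>
        cases t <;> simp [rotateAxis, Turn.inverse]
    · rcases fin3_cases a with rfl | rfl | rfl <;> rcases fin3_cases e with rfl | rfl | rfl <;>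
        cases t <;> cases s <;> simp [rotateAxis, rotateSign, Turn.inverse]
  · simp [Facelet.rotate, Move.inverse, h]

/-- A move carries the color of each visible face along. -/
theorem applyMove_rotate {d : Fin 3 → ℕ} (C : Config d) (m : Move d) (f : Facelet d) :
    applyMove C m (f.rotate m) = C f := by
  simp [applyMove, rotate_rotate_inverse]

/-- A solution of `C`: a sequence of legal moves, performed from left to right, that leads from
`C` to a solved configuration. -/
def IsSolution {d : Fin 3 → ℕ} (C : Config d) (s : List (Move d)) : Prop :=
  Solved (s.foldl applyMove C)

/-- A solution with the smallest possible number of moves. -/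
def IsOptimalSolution {d : Fin 3 → ℕ} (C : Config d) (s : List (Move d)) : Prop :=
  IsSolution C s ∧ ∀ s' : List (Move d), IsSolution C s' → s.length ≤ s'.length

/-- `r` is a correct answer to the problem of optimally solving `C`: an optimal solution,
or `none` if `C` has no solution. -/
def IsAnswer {d : Fin 3 → ℕ} (C : Config d) : Option (List (Move d)) → Prop
  | some s => IsOptimalSolution C s
  | none => ∀ s, ¬ IsSolution C s

/-- The dimensions of the `c₁ × c₂ × n` Rubik's Cube. -/
abbrev dims (c₁ c₂ n : ℕ) : Fin 3 → ℕ := ![c₁, c₂, n]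

/-- A short move rotates a slice `z = const`; a long move rotates any other slice. -/
def Move.IsShort {d : Fin 3 → ℕ} (m : Move d) : Prop := m.axis = 2

instance {d : Fin 3 → ℕ} (m : Move d) : Decidable m.IsShort :=
  inferInstanceAs (Decidable (m.axis = 2))

/-- Number of long moves in a sequence of moves. -/
def longMoves {d : Fin 3 → ℕ} (s : List (Move d)) : ℕ :=
  s.countP fun m => ¬ m.IsShort

/-- Number of short moves in a sequence of moves that rotate one of the (at most two) slices
`z = i` and `z = (d 2 - 1) - i` of cubie cluster `i`. -/
def shortMoves {d : Fin 3 → ℕ} (i : ℕ) (s : List (Move d)) : ℕ :=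
  s.countP fun m => m.IsShort ∧ (m.index = i ∨ m.index = (d 2 - 1) - i)

/-- The color of the face with the given normal of the cubie at position `p`,
or `none` if there is no such visible face. -/
def colorAt {d : Fin 3 → ℕ} (C : Config d) (p : Fin 3 → ℕ) (a : Fin 3) (s : Bool) :
    Option Color :=
  if h : (∀ b, p b < d b) ∧ p a = if s then d a - 1 else 0 then
    some (C ⟨p, a, s, h.1, h.2⟩)
  else none

/-- A configuration as a string over the alphabet `Option Color`: slice by slice in the direction
of the third coordinate, each cubie as a block of six symbols, one for each of its faces. -/
def encodeConfig {d : Fin 3 → ℕ} (C : Config d) : List (Option Color) :=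
  (List.range (d 2)).flatMap fun z =>
    (List.range (d 0)).flatMap fun x =>
      (List.range (d 1)).flatMap fun y =>
        (List.finRange 3).flatMap fun a =>
          [false, true].map fun s => colorAt C ![x, y, z] a s

/-- The output alphabet. -/
inductive OutSym
  | axis (a : Fin 3)
  | tick
  | turn (t : Turn)
  | unsolvable

/-- A move as a string: the axis, the index of the slice in unary, the rotation. -/
def encodeMove {d : Fin 3 → ℕ} (m : Move d) : List OutSym :=
  OutSym.axis m.axis :: (List.replicate m.index OutSym.tick ++ [OutSym.turn m.turn])

/-- An answer as a string: the moves one after the other, or the symbol `unsolvable`. -/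
def encodeAnswer {d : Fin 3 → ℕ} : Option (List (Move d)) → List OutSym
  | some s => s.flatMap encodeMove
  | none => [OutSym.unsolvable]

end RubikCube

/-! ### Abstract cluster systems: economizing short and long moves -/

namespace RubikCube
open Function

/-! Pair the slice z with its mirror slice n-1-z. As n differs from c₁ and c₂, every long move is a
half turn; it exchanges the mirror slices' affected faces, so it acts on each pair (cluster)
separately, and as an involution. A short move changes one cluster only. Hence, once the sequence of
long moves and the target coloring are fixed, the clusters are solved independently of each other,
and each is a point of a finite set X that does not depend on n.

Fix the long moves and watch one cluster, undoing at each moment the long moves made so far. The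
state normalized in this way changes only by short moves, and if it recurs, the short moves in
between can be dropped. So fewer than |X| short moves suffice (`exists_nodup_trace`,
`Attains.exists_lt_card`). All that matters about a sequence of long moves is therefore its
`profile`: the costs below |X| that it permits for each target and each state. There are finitely
many profiles, and a sequence of long moves may be replaced by a `shortest` one with the same
profile. This turns every solution into one that is no longer in any of its parts, with bounded long
part and bounded cost per cluster (`FamSolves.exists_candidate_le`); an optimal solution cannot lose
to it, which gives the bounds (`FamSolves.bounds`).

For the algorithm, the pairs of a profile and a target form a finite set of candidates, independent
of n. Feasibility, cost and moves for each candidate and cluster state form a finite table that is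
wired into the control of a stack machine. The machine pairs the slices, adds up costs and stores
moves for all candidates at once, finds a cheapest feasible candidate by a common countdown, and
prints it; only slice indices grow with n, and they are kept in unary. `StackMachine.Runs.outputs`
carries this over to `Turing.FinTM2`, and `cubeMachine_spec` combines everything. -/

/-- The possible states of a cubie cluster: long moves act on all clusters at once, short moves on
a single cluster, where they are available only in legal states; `good t` holds for the states
that are solved with the target coloring `t`. -/
structure ClusterSystem (X L S T : Type) where
  long : L → X → X
  short : S → X → X
  legal : X → Prop
  good : T → X → Prop
  long_involutive : ∀ l, Involutive (long l)
  legal_long : ∀ l x, legal (long l x) ↔ legal x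
  legal_short : ∀ s x, legal (short s x) ↔ legal x

/-- The long moves of a sequence of moves. -/
def longs {L R : Type} (v : List (L ⊕ R)) : List L := v.filterMap Sum.getLeft?

/-- The number of short moves of a sequence of moves. -/
def cost {L R : Type} (v : List (L ⊕ R)) : ℕ := v.countP Sum.isRight

section
variable {L R : Type}

@[simp] theorem longs_nil : longs ([] : List (L ⊕ R)) = [] := rfl
@[simp] theorem longs_inl (l : L) (v : List (L ⊕ R)) : longs (Sum.inl l :: v) = l :: longs v := rfl
@[simp] theorem longs_inr (s : R) (v : List (L ⊕ R)) : longs (Sum.inr s :: v) = longs v := rfl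
@[simp] theorem cost_nil : cost ([] : List (L ⊕ R)) = 0 := rfl
@[simp] theorem cost_inl (l : L) (v : List (L ⊕ R)) : cost (Sum.inl l :: v) = cost v := by
  simp [cost]
@[simp] theorem cost_inr (s : R) (v : List (L ⊕ R)) : cost (Sum.inr s :: v) = cost v + 1 := by
  simp [cost, List.countP_cons]
@[simp] theorem longs_append (v v' : List (L ⊕ R)) : longs (v ++ v') = longs v ++ longs v' := by
  simp [longs]

theorem exists_inr_mem_of_cost_pos {v : List (L ⊕ R)} (h : 0 < cost v) :
    ∃ s, Sum.inr s ∈ v := by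
  obtain ⟨a, ha, h⟩ := List.countP_pos_iff.1 h
  obtain ⟨s, rfl⟩ := Sum.isRight_iff.1 h
  exact ⟨s, ha⟩

theorem cost_pos_of_mem {v : List (L ⊕ R)} {s : R} (h : Sum.inr s ∈ v) : 0 < cost v :=
  List.countP_pos_iff.2 ⟨_, h, rfl⟩

end

/-- The short moves of `v` after its first `j` and before its next long move. -/
def segment {L S : Type} : List (L ⊕ S) → ℕ → List S
  | [], _ => []
  | Sum.inl _ :: _, 0 => []
  | Sum.inl _ :: v, j + 1 => segment v j
  | Sum.inr s :: v, 0 => s :: segment v 0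
  | Sum.inr _ :: v, j + 1 => segment v (j + 1)

/-- The sequence with long moves `w` and with the short moves `h j` after the first `j` of them. -/
def interleave {L S : Type} : List L → (ℕ → List S) → List (L ⊕ S)
  | [], h => (h 0).map Sum.inr
  | l :: w, h => (h 0).map Sum.inr ++ Sum.inl l :: interleave w (fun j => h (j + 1))

theorem interleave_segment {L S : Type} (v : List (L ⊕ S)) :
    interleave (longs v) (segment v) = v := by
  induction v with
  | nil => rfl
  | cons a v ih =>
    rcases a with l | s
    · simp only [longs_inl, interleave, segment, List.map_nil, List.nil_append]
      congr 1
    · rw [longs_inr]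
      rcases hw : longs v with _ | ⟨l, w⟩
      · rw [hw] at ih
        simp only [interleave, segment, List.map_cons] at ih ⊢
        rw [ih]
      · rw [hw] at ih
        simp only [interleave, segment, List.map_cons, List.cons_append] at ih ⊢
        rw [ih]

namespace ClusterSystem
variable {X L S T : Type} (D : ClusterSystem X L S T)

def act : L ⊕ S → X → X := Sum.elim D.long D.short

def run (v : List (L ⊕ S)) (x : X) : X := v.foldl (fun x a => D.act a x) x

@[simp] theorem run_inl (l : L) (v : List (L ⊕ S)) (x : X) :
    D.run (Sum.inl l :: v) x = D.run v (D.long l x) := rfl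
@[simp] theorem run_inr (s : S) (v : List (L ⊕ S)) (x : X) :
    D.run (Sum.inr s :: v) x = D.run v (D.short s x) := rfl

/-- The states passed by `v`, seen in the frame moved along by the long moves. -/
def trace : List (L ⊕ S) → X → List X
  | [], x => [x]
  | Sum.inl l :: v, x => (trace v (D.long l x)).map (D.long l)
  | Sum.inr s :: v, x => x :: trace v (D.short s x)

/-- Long moves only relabel the trace, short moves add one entry each. A trace without repetitions
therefore bounds the number of short moves by the number of states. -/
theorem length_trace (v : List (L ⊕ S)) (x : X) : (D.trace v x).length = cost v + 1 := by
  induction v generalizing x with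
  | nil => rfl
  | cons a v ih => rcases a with l | s <;> simp [trace, ih]

/-- The shortcut: if `x` occurs in the trace, then the long moves made up to that occurrence carry
`x` to the state that `v` has reached there, so all earlier short moves can be left out. Undoing
long moves works because they are involutions. -/
theorem exists_of_mem_trace (v : List (L ⊕ S)) (x z : X) (h : x ∈ D.trace v z)
    (hn : (D.trace v z).Nodup) :
    ∃ v', longs v' = longs v ∧ D.run v' x = D.run v z ∧ cost v' ≤ cost v ∧
      (D.trace v' x).Nodup := by
  induction v generalizing x z with
  | nil =>
    obtain rfl : x = z := by simpa [trace] using h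
    exact ⟨[], rfl, rfl, le_rfl, hn⟩
  | cons a v ih =>
    rcases a with l | s
    · simp only [trace] at h hn
      obtain ⟨y, hy, rfl⟩ := List.mem_map.1 h
      obtain ⟨v', h1, h2, h3, h4⟩ := ih y _ hy (hn.of_map _)
      refine ⟨Sum.inl l :: v', by simp [h1], ?_, by simpa using h3, ?_⟩
      · simp [D.long_involutive l y, h2]
      · simp only [trace, D.long_involutive l y]
        exact h4.map (D.long_involutive l).injective
    · rw [trace, List.mem_cons] at h
      by_cases hx : x = z
      · subst hx
        exact ⟨_, rfl, rfl, le_rfl, hn⟩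
      · have hn' := hn
        rw [trace, List.nodup_cons] at hn'
        obtain ⟨v', h1, h2, h3, h4⟩ := ih x _ (h.resolve_left hx) hn'.2
        exact ⟨v', by simpa using h1, by simpa using h2, by simp; omega, h4⟩

/-- Built from the end: when a short move is put in front of a sequence already without repetitions,
either its starting state is new, or the shortcut from the recurrence of that state makes the move
superfluous. -/
theorem exists_nodup_trace (v : List (L ⊕ S)) (x : X) :
    ∃ v', longs v' = longs v ∧ D.run v' x = D.run v x ∧ cost v' ≤ cost v ∧
      (D.trace v' x).Nodup := by
  induction v generalizing x with
  | nil => exact ⟨[], rfl, rfl, le_rfl, by simp [trace]⟩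
  | cons a v ih =>
    rcases a with l | s
    · obtain ⟨v', h1, h2, h3, h4⟩ := ih (D.long l x)
      exact ⟨Sum.inl l :: v', by simp [h1], by simp [h2], by simpa using h3,
        h4.map (D.long_involutive l).injective⟩
    · obtain ⟨v', h1, h2, h3, h4⟩ := ih (D.short s x)
      by_cases hx : x ∈ D.trace v' (D.short s x)
      · obtain ⟨v'', k1, k2, k3, k4⟩ := D.exists_of_mem_trace _ _ _ hx h4
        exact ⟨v'', by simp [k1, h1], by simp [k2, h2], by simp; omega, k4⟩
      · exact ⟨Sum.inr s :: v', by simp [h1], by simp [h2], by simp; omega,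
          List.nodup_cons.2 ⟨hx, h4⟩⟩

/-- `w` with `c` legal short moves in between leads from `x` to a state solved with target `t`. -/
def Attains (w : List L) (t : T) (x : X) (c : ℕ) : Prop :=
  ∃ v, longs v = w ∧ (0 < cost v → D.legal x) ∧ D.good t (D.run v x) ∧ cost v = c

/-- The trace has one entry more than there are short moves, which makes the bound strict. Dropping
moves preserves legality, which is required only if a short move remains. -/
theorem Attains.exists_lt_card [Fintype X] {D : ClusterSystem X L S T} {w : List L} {t : T} {x : X}
    {c : ℕ} (h : D.Attains w t x c) : ∃ c' ≤ c, c' < Fintype.card X ∧ D.Attains w t x c' := by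
  obtain ⟨v, h1, h2, h3, rfl⟩ := h
  obtain ⟨v', k1, k2, k3, k4⟩ := D.exists_nodup_trace v x
  have := k4.length_le_card
  rw [length_trace] at this
  exact ⟨cost v', k3, by omega, v', k1.trans h1, fun h => h2 (by omega), k2 ▸ h3, rfl⟩

/-- The numbers of short moves needed along `w`, as an element of a finite type. -/
def profile [Fintype X] (w : List L) : T → X → Set (Fin (Fintype.card X)) :=
  fun t x => {c | D.Attains w t x c}

/-- If `p` is no profile, any `w'` will do. The totality lets all functions `p`, a finite set when
`T` is finite too, index the candidates. -/
theorem exists_shortest [Fintype X] (p : T → X → Set (Fin (Fintype.card X))) :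
    ∃ w', ∀ w, D.profile w = p → D.profile w' = p ∧ w'.length ≤ w.length := by
  by_cases h : ∃ w, D.profile w = p
  · obtain ⟨w', hw', hmin⟩ := exists_minimalFor_of_wellFoundedLT
      (fun w => D.profile w = p) List.length h
    exact ⟨w', fun w hw => ⟨hw', (le_total _ _).elim id (hmin hw)⟩⟩
  · exact ⟨[], fun w hw => (h ⟨w, hw⟩).elim⟩

/-- A shortest sequence of long moves with the given profile. -/
noncomputable def shortest [Fintype X] (p : T → X → Set (Fin (Fintype.card X))) : List L :=
  (D.exists_shortest p).choose

theorem profile_shortest [Fintype X] (w : List L) :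
    D.profile (D.shortest (D.profile w)) = D.profile w :=
  ((D.exists_shortest _).choose_spec w rfl).1

theorem length_shortest_le [Fintype X] (w : List L) :
    (D.shortest (D.profile w)).length ≤ w.length :=
  ((D.exists_shortest _).choose_spec w rfl).2

/-- Equal profiles say nothing about costs of `Fintype.card X` or more, hence the bound on `c`. -/
theorem Attains.shortest [Fintype X] {D : ClusterSystem X L S T} {w : List L} {t : T} {x : X}
    {c : ℕ} (h : D.Attains w t x c) (hc : c < Fintype.card X) :
    D.Attains (D.shortest (D.profile w)) t x c := by
  have h' : (⟨c, hc⟩ : Fin _) ∈ D.profile w t x := h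
  rwa [← D.profile_shortest w] at h'

/-- The least number of short moves needed along `w`. -/
noncomputable def minCost (w : List L) (t : T) (x : X) : ℕ := sInf {c | D.Attains w t x c}

/-- An optimal way to insert short moves into `w`. -/
noncomputable def plan (w : List L) (t : T) (x : X) : List (L ⊕ S) :=
  open Classical in
  if h : D.Attains w t x (D.minCost w t x) then h.choose else []

/-- The infimum of the empty set is 0, so `minCost` is meaningful only in the presence of some
attained cost. -/
theorem Attains.minCost {D : ClusterSystem X L S T} {w : List L} {t : T} {x : X}
    {c : ℕ} (h : D.Attains w t x c) : D.Attains w t x (D.minCost w t x) :=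
  Nat.sInf_mem (s := {c | D.Attains w t x c}) ⟨c, h⟩

theorem Attains.minCost_le {D : ClusterSystem X L S T} {w : List L} {t : T} {x : X}
    {c : ℕ} (h : D.Attains w t x c) : D.minCost w t x ≤ c :=
  Nat.sInf_le h

theorem Attains.plan_spec {D : ClusterSystem X L S T} {w : List L} {t : T} {x : X}
    {c : ℕ} (h : D.Attains w t x c) : longs (D.plan w t x) = w ∧
      (0 < cost (D.plan w t x) → D.legal x) ∧ D.good t (D.run (D.plan w t x) x) ∧
      cost (D.plan w t x) = D.minCost w t x := by
  rw [plan, dif_pos h.minCost]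
  exact h.minCost.choose_spec

/-! ### Families of clusters that share their long moves -/

section Family
variable {ι : Type} [DecidableEq ι]

/-- The action of a move on a family of clusters. -/
def famAct : L ⊕ (ι × S) → (ι → X) → ι → X
  | Sum.inl l, ξ => fun i => D.long l (ξ i)
  | Sum.inr (i, s), ξ => update ξ i (D.short s (ξ i))

def famRun (u : List (L ⊕ (ι × S))) (ξ : ι → X) : ι → X := u.foldl (fun ξ a => D.famAct a ξ) ξ

end Family
end ClusterSystem

/-- The moves of a sequence that affect cluster `i`. -/
def proj {L S ι : Type} [DecidableEq ι] (i : ι) : List (L ⊕ (ι × S)) → List (L ⊕ S) :=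
  List.filterMap fun
    | Sum.inl l => some (Sum.inl l)
    | Sum.inr (j, s) => if j = i then some (Sum.inr s) else none

section
variable {L S ι : Type} [DecidableEq ι]

@[simp] theorem proj_nil (i : ι) : proj i ([] : List (L ⊕ (ι × S))) = [] := rfl
@[simp] theorem proj_inl (i : ι) (l : L) (u : List (L ⊕ (ι × S))) :
    proj i (Sum.inl l :: u) = Sum.inl l :: proj i u := rfl
theorem proj_inr (i j : ι) (s : S) (u : List (L ⊕ (ι × S))) :
    proj i (Sum.inr (j, s) :: u) = if j = i then Sum.inr s :: proj i u else proj i u := by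
  by_cases h : j = i <;> simp [proj, h]
@[simp] theorem proj_append (i : ι) (u u' : List (L ⊕ (ι × S))) :
    proj i (u ++ u') = proj i u ++ proj i u' := by
  simp [proj]

theorem longs_proj (i : ι) (u : List (L ⊕ (ι × S))) : longs (proj i u) = longs u := by
  induction u with
  | nil => rfl
  | cons a u ih =>
    rcases a with l | ⟨j, s⟩
    · simp [ih]
    · rw [proj_inr]
      split <;> simp [ih]

/-- Each short move belongs to exactly one cluster. Together with `length_eq` this splits the length
of a solution into its long part and one term per cluster, which can be minimized separately. -/
theorem sum_cost_proj [Fintype ι] (u : List (L ⊕ (ι × S))) :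
    ∑ i, cost (proj i u) = cost u := by
  induction u with
  | nil => simp
  | cons a u ih =>
    rcases a with l | ⟨j, s⟩
    · simp [ih]
    · have : ∀ i, cost (proj i (Sum.inr (j, s) :: u)) =
          cost (proj i u) + if j = i then 1 else 0 := by
        intro i
        rw [proj_inr]
        split <;> simp
      simp [this, Finset.sum_add_distrib, ih]

theorem length_eq {L R : Type} (u : List (L ⊕ R)) : u.length = (longs u).length + cost u := by
  induction u with
  | nil => rfl
  | cons a u ih => rcases a with l | r <;> simp [ih] <;> omega

theorem proj_map_inr (i j : ι) (h : List S) :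
    proj i (h.map fun s => (Sum.inr (j, s) : L ⊕ (ι × S))) =
      if j = i then h.map Sum.inr else [] := by
  induction h with
  | nil => simp
  | cons s h ih =>
    rw [List.map_cons, proj_inr, ih]
    split <;> simp

/-- All clusters' short moves `h i`, for `i` in the list `is`. -/
def famSegment (is : List ι) (h : ι → List S) : List (L ⊕ (ι × S)) :=
  is.flatMap fun i => (h i).map fun s => Sum.inr (i, s)

/-- The sequence with long moves `w` and the short moves `h i j` of cluster `i` after the first
`j` of them. -/
def famInterleave (is : List ι) : List L → (ι → ℕ → List S) → List (L ⊕ (ι × S))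
  | [], h => famSegment is fun i => h i 0
  | l :: w, h => (famSegment is fun i => h i 0) ++
      Sum.inl l :: famInterleave is w fun i j => h i (j + 1)

theorem proj_famSegment {is : List ι} (hn : is.Nodup) {i : ι} (hi : i ∈ is) (h : ι → List S) :
    proj i (famSegment (L := L) is h) = (h i).map Sum.inr := by
  -- The induction passes to tails that may no longer contain `i`, so this case is included.
  have key : ∀ is : List ι, is.Nodup → proj i (famSegment (L := L) is h) =
      if i ∈ is then (h i).map Sum.inr else [] := by
    intro is hn
    induction is with
    | nil => simp [famSegment]
    | cons j is ih =>
      rw [List.nodup_cons] at hn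
      have ih := ih hn.2
      simp only [famSegment] at ih
      rw [famSegment, List.flatMap_cons, proj_append, ih, proj_map_inr]
      by_cases hj : j = i
      · subst hj
        simp [hn.1]
      · simp [hj, Ne.symm hj]
  rw [key is hn, if_pos hi]

/-- Sequences for the single clusters can be merged as soon as they have the same long moves; each
cluster then sees exactly its own sequence. -/
theorem proj_famInterleave {is : List ι} (hn : is.Nodup) {i : ι} (hi : i ∈ is) (w : List L)
    (h : ι → ℕ → List S) : proj i (famInterleave is w h) = interleave w (h i) := by
  induction w generalizing h with
  | nil => simp [famInterleave, interleave, proj_famSegment hn hi]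
  | cons l w ih => simp [famInterleave, interleave, proj_famSegment hn hi, ih]

theorem mem_proj {i : ι} {s : S} {u : List (L ⊕ (ι × S))} :
    Sum.inr s ∈ proj i u ↔ Sum.inr (i, s) ∈ u := by
  induction u with
  | nil => simp
  | cons a u ih =>
    rcases a with l | ⟨j, s'⟩
    · simp [ih]
    · rw [proj_inr]
      by_cases hj : j = i
      · subst hj
        simp [ih]
      · simp [hj, ih, Ne.symm hj]

end

theorem longs_famSegment {L S ι : Type} (is : List ι) (h : ι → List S) :
    longs (famSegment (L := L) is h) = [] := by
  induction is with
  | nil => rfl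
  | cons i is ih =>
    rw [famSegment, List.flatMap_cons, longs_append]
    rw [famSegment] at ih
    rw [ih]
    induction h i <;> simp_all

theorem longs_famInterleave {L S ι : Type} (is : List ι) (w : List L) (h : ι → ℕ → List S) :
    longs (famInterleave is w h) = w := by
  induction w generalizing h with
  | nil => simp [famInterleave, longs_famSegment]
  | cons l w ih => simp [famInterleave, longs_famSegment, ih]

namespace ClusterSystem
variable {X L S T : Type} (D : ClusterSystem X L S T) {ι : Type} [DecidableEq ι]

theorem famRun_apply (u : List (L ⊕ (ι × S))) (ξ : ι → X) (i : ι) :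
    D.famRun u ξ i = D.run (proj i u) (ξ i) := by
  induction u generalizing ξ with
  | nil => rfl
  | cons a u ih =>
    rcases a with l | ⟨j, s⟩
    · simp only [proj_inl, run_inl]
      exact ih _
    · rw [proj_inr]
      have : D.famRun (Sum.inr (j, s) :: u) ξ i = D.famRun u (update ξ j (D.short s (ξ j))) i := rfl
      rw [this, ih]
      by_cases h : j = i
      · subst h
        simp
      · simp [h, Function.update_of_ne (Ne.symm h)]

/-- The sequence `u` of legal moves solves the family `ξ`. -/
def FamSolves (u : List (L ⊕ (ι × S))) (ξ : ι → X) : Prop :=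
  (∀ i s, Sum.inr (i, s) ∈ u → D.legal (ξ i)) ∧ ∃ t, ∀ i, D.good t (D.famRun u ξ i)

theorem FamSolves.attains {D : ClusterSystem X L S T} {u : List (L ⊕ (ι × S))} {ξ : ι → X}
    (h : D.FamSolves u ξ) : ∃ t, ∀ i, D.Attains (longs u) t (ξ i) (cost (proj i u)) := by
  obtain ⟨h1, t, h2⟩ := h
  refine ⟨t, fun i => ⟨proj i u, longs_proj i u, fun hc => ?_, ?_, rfl⟩⟩
  · obtain ⟨s, hs⟩ := exists_inr_mem_of_cost_pos hc
    exact h1 i s (mem_proj.1 hs)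
  · rw [← D.famRun_apply]
    exact h2 i

theorem famSolves_famInterleave {is : List ι} (hn : is.Nodup) (his : ∀ i, i ∈ is) {w : List L}
    {t : T} {ξ : ι → X} (v : ι → List (L ⊕ S)) (hw : ∀ i, longs (v i) = w)
    (hl : ∀ i, 0 < cost (v i) → D.legal (ξ i)) (hg : ∀ i, D.good t (D.run (v i) (ξ i))) :
    D.FamSolves (famInterleave is w fun i => segment (v i)) ξ := by
  have hp : ∀ i, proj i (famInterleave is w fun i => segment (v i)) = v i := by
    intro i
    rw [proj_famInterleave hn (his i), ← hw i, interleave_segment]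
  refine ⟨fun i s h => hl i ?_, t, fun i => ?_⟩
  · rw [← mem_proj, hp] at h
    exact cost_pos_of_mem h
  · rw [famRun_apply, hp]
    exact hg i

theorem length_famInterleave [Fintype ι] {is : List ι} (hn : is.Nodup) (his : ∀ i, i ∈ is)
    {w : List L} (v : ι → List (L ⊕ S)) (hw : ∀ i, longs (v i) = w) :
    (famInterleave is w fun i => segment (v i)).length = w.length + ∑ i, cost (v i) := by
  rw [length_eq, longs_famInterleave, ← sum_cost_proj]
  congr 1
  refine Finset.sum_congr rfl fun i _ => ?_
  rw [proj_famInterleave hn (his i), ← hw i, interleave_segment]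

/-- The candidate solution with target `t` along `w`. -/
noncomputable def candidate (is : List ι) (w : List L) (t : T) (ξ : ι → X) :
    List (L ⊕ (ι × S)) :=
  famInterleave is w fun i => segment (D.plan w t (ξ i))

theorem candidate_spec [Fintype ι] {is : List ι} (hn : is.Nodup) (his : ∀ i, i ∈ is)
    {w : List L} {t : T} {ξ : ι → X} (h : ∀ i, ∃ c, D.Attains w t (ξ i) c) :
    D.FamSolves (D.candidate is w t ξ) ξ ∧
      (D.candidate is w t ξ).length = w.length + ∑ i, D.minCost w t (ξ i) := by
  choose c hc using h
  refine ⟨D.famSolves_famInterleave (t := t) hn his _ (fun i => (hc i).plan_spec.1)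
    (fun i => (hc i).plan_spec.2.1) (fun i => (hc i).plan_spec.2.2.1), ?_⟩
  rw [candidate, length_famInterleave hn his _ fun i => (hc i).plan_spec.1]
  congr 1
  exact Finset.sum_congr rfl fun i _ => (hc i).plan_spec.2.2.2

/-- Each solution is at least as long as some candidate along one of finitely many sequences of
long moves. -/
theorem FamSolves.exists_candidate_le [Fintype X] [Fintype ι] {D : ClusterSystem X L S T}
    {u : List (L ⊕ (ι × S))} {ξ : ι → X} (h : D.FamSolves u ξ) :
    ∃ t, (∀ i, ∃ c, D.Attains (D.shortest (D.profile (longs u))) t (ξ i) c) ∧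
      (∀ i, D.minCost (D.shortest (D.profile (longs u))) t (ξ i) < Fintype.card X) ∧
      (∀ i, D.minCost (D.shortest (D.profile (longs u))) t (ξ i) ≤ cost (proj i u)) := by
  obtain ⟨t, ht⟩ := h.attains
  -- The cost has to be cut below `Fintype.card X` before the equality of profiles can transfer it
  -- to the shortest sequence of long moves.
  have key : ∀ i, ∃ c, c ≤ cost (proj i u) ∧ c < Fintype.card X ∧
      D.Attains (D.shortest (D.profile (longs u))) t (ξ i) c := by
    intro i
    obtain ⟨c, h1, h2, h3⟩ := (ht i).exists_lt_card
    exact ⟨c, h1, h2, h3.shortest h2⟩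
  choose c h1 h2 h3 using key
  exact ⟨t, fun i => ⟨c i, h3 i⟩, fun i => (h3 i).minCost_le.trans_lt (h2 i),
    fun i => (h3 i).minCost_le.trans (h1 i)⟩

/-- In a shortest solution, the number of short moves of each cluster and the number of long moves
are bounded independently of the number of clusters. -/
theorem FamSolves.bounds [Fintype X] [Fintype ι] {D : ClusterSystem X L S T} {B : ℕ}
    (hB : ∀ p, (D.shortest p).length ≤ B) {u : List (L ⊕ (ι × S))} {ξ : ι → X}
    (h : D.FamSolves u ξ) (hopt : ∀ u', D.FamSolves u' ξ → u.length ≤ u'.length) :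
    (∀ i, cost (proj i u) ≤ Fintype.card X) ∧ (longs u).length ≤ B := by
  classical
  obtain ⟨t, h1, h2, h3⟩ := h.exists_candidate_le
  have hc := D.candidate_spec (Finset.nodup_toList Finset.univ)
    (fun i => Finset.mem_toList.2 (Finset.mem_univ i)) h1
  -- The candidate is at most as long as `u` both in its long part and in each cluster. As `u` is
  -- shortest, none of these terms can be strictly smaller.
  have hle := hopt _ hc.1
  rw [hc.2, length_eq, ← sum_cost_proj] at hle
  have hw := D.length_shortest_le (longs u)
  have hsum := Finset.sum_le_sum fun i (_ : i ∈ Finset.univ) => h3 i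
  refine ⟨fun i => ?_, ?_⟩
  · by_contra hi
    have := Finset.sum_lt_sum (fun i (_ : i ∈ Finset.univ) => h3 i)
      ⟨i, Finset.mem_univ i, by have := h2 i; omega⟩
    omega
  · have := hB (D.profile (longs u))
    omega

end ClusterSystem
end RubikCube

/-! ### The cube as a family of clusters -/

namespace RubikCube
open Function

theorem rotate_inverse_rotate {d : Fin 3 → ℕ} (m : Move d) {p : Fin 3 → ℕ} (hp : ∀ a, p a < d a)
    (e : Fin 3) (s : Bool) :
    rotatePos d m.axis m.turn (rotatePos d m.axis m.turn.inverse p) = p ∧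
      rotateAxis m.axis m.turn (rotateAxis m.axis m.turn.inverse e) = e ∧
      rotateSign m.axis m.turn (rotateAxis m.axis m.turn.inverse e)
        (rotateSign m.axis m.turn.inverse e s) = s := by
  have ht := m.turn_legal
  have h0 := hp 0
  have h1 := hp 1
  have h2 := hp 2
  generalize m.axis = a at *
  generalize m.turn = t at *
  clear hp
  refine ⟨funext fun b => ?_, ?_, ?_⟩
  · rcases fin3_cases a with rfl | rfl | rfl <;> rcases fin3_cases b with rfl | rfl | rfl <;>
      cases t <;> simp [rotatePos, Turn.inverse] at ht ⊢ <;> omega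
  · rcases fin3_cases a with rfl | rfl | rfl <;> rcases fin3_cases e with rfl | rfl | rfl <;>
      cases t <;> simp [rotateAxis, Turn.inverse]
  · rcases fin3_cases a with rfl | rfl | rfl <;> rcases fin3_cases e with rfl | rfl | rfl <;>
      cases t <;> cases s <;> simp [rotateAxis, rotateSign, Turn.inverse]

/-- The formula holds for invisible faces too, because a move and its inverse preserve visibility.
So a move acts on slices without any reference to which faces are visible. -/
theorem colorAt_applyMove {d : Fin 3 → ℕ} (C : Config d) (m : Move d) {p : Fin 3 → ℕ}
    (hp : ∀ a, p a < d a) (a : Fin 3) (s : Bool) :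
    colorAt (applyMove C m) p a s = if p m.axis = m.index then
      colorAt C (rotatePos d m.axis m.turn.inverse p) (rotateAxis m.axis m.turn.inverse a)
        (rotateSign m.axis m.turn.inverse a s) else colorAt C p a s := by
  by_cases hv : p a = if s then d a - 1 else 0
  · have h : colorAt (applyMove C m) p a s = some (C (Facelet.rotate m.inverse ⟨p, a, s, hp, hv⟩)) :=
      dif_pos ⟨hp, hv⟩
    rw [h, Facelet.rotate]
    by_cases hi : p m.axis = m.index
    · have hi' : p m.inverse.axis = m.inverse.index := hi
      simp only [hi, hi', if_true]
      rw [colorAt, dif_pos ⟨rotatePos_lt m.inverse hp,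
        rotatePos_visible m.inverse ⟨p, a, s, hp, hv⟩⟩]
      rfl
    · have hi' : ¬ p m.inverse.axis = m.inverse.index := hi
      simp only [hi, hi', if_false]
      rw [colorAt, dif_pos ⟨hp, hv⟩]
  · have h : ∀ C : Config d, colorAt C p a s = none := fun C => dif_neg fun h => hv h.2
    rw [h, h]
    split
    · rw [colorAt, dif_neg]
      rintro ⟨h1, h2⟩
      -- If the preimage were visible, rotating it forward again would make the given face visible.
      have := rotatePos_visible m ⟨_, _, _, h1, h2⟩
      obtain ⟨e1, e2, e3⟩ := rotate_inverse_rotate m hp a s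
      simp only [e1, e2, e3] at this
      exact hv this
    · rfl

/-- The colors of the visible faces of a slice `z = const`. -/
abbrev Slice (c₁ c₂ : ℕ) : Type := Fin c₁ → Fin c₂ → Fin 3 → Bool → Option Color

variable {c₁ c₂ n : ℕ}

def Slice.get (S : Slice c₁ c₂) (x y : ℕ) (a : Fin 3) (s : Bool) : Option Color :=
  if h : x < c₁ ∧ y < c₂ then S ⟨x, h.1⟩ ⟨y, h.2⟩ a s else none

def sliceOf (C : Config (dims c₁ c₂ n)) (z : ℕ) : Slice c₁ c₂ :=
  fun x y a s => colorAt C ![x, y, z] a s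

theorem get_sliceOf (C : Config (dims c₁ c₂ n)) (z : ℕ) {x y : ℕ} (hx : x < c₁) (hy : y < c₂)
    (a : Fin 3) (s : Bool) : (sliceOf C z).get x y a s = colorAt C ![x, y, z] a s := by
  rw [Slice.get, dif_pos ⟨hx, hy⟩]
  rfl

/-- The effect of a short move on its slice. -/
def turnSlice (t : Turn) (S : Slice c₁ c₂) : Slice c₁ c₂ := fun x y a s =>
  -- The height plays no role in a turn around axis 2, so the slice is treated as a cube of height
  -- 1.
  let p := rotatePos (dims c₁ c₂ 1) 2 t.inverse ![x, y, 0]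
  S.get (p 0) (p 1) (rotateAxis 2 t.inverse a) (rotateSign 2 t.inverse a s)

/-- The long moves: half turns of the slices `x = const` and `y = const`. -/
abbrev LongMove (c₁ c₂ : ℕ) : Type := {_x : Fin c₁ // c₁ ≠ 1} ⊕ {_y : Fin c₂ // c₂ ≠ 1}

/-- The effect of a long move on the slice `S` whose mirror image is `S'`. -/
def flipSlice : LongMove c₁ c₂ → Slice c₁ c₂ → Slice c₁ c₂ → Slice c₁ c₂
  | Sum.inl k, S, S' => fun x y a s =>
      if x = k.1 then S' x y.rev a (if a = 0 then s else !s) else S x y a s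
  | Sum.inr k, S, S' => fun x y a s =>
      if y = k.1 then S' x.rev y a (if a = 1 then s else !s) else S x y a s

theorem flipSlice_flipSlice (l : LongMove c₁ c₂) (S S' : Slice c₁ c₂) :
    flipSlice l (flipSlice l S S') (flipSlice l S' S) = S := by
  funext x y a s
  rcases l with k | k
  · by_cases h : x = k.1 <;> by_cases ha : a = 0 <;> simp [flipSlice, h, ha]
  · by_cases h : y = k.1 <;> by_cases ha : a = 1 <;> simp [flipSlice, h, ha]

theorem range_dims {x y z : ℕ} (hx : x < c₁) (hy : y < c₂) (hz : z < n) (a : Fin 3) :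
    (![x, y, z] : Fin 3 → ℕ) a < dims c₁ c₂ n a := by
  rcases fin3_cases a with rfl | rfl | rfl <;> simpa

theorem rotatePos_two (t : Turn) (x y z : ℕ) : rotatePos (dims c₁ c₂ n) 2 t ![x, y, z] =
    ![rotatePos (dims c₁ c₂ 1) 2 t ![x, y, 0] 0, rotatePos (dims c₁ c₂ 1) 2 t ![x, y, 0] 1, z] := by
  funext e
  rcases fin3_cases e with rfl | rfl | rfl <;> cases t <;> simp [rotatePos]

theorem sliceOf_applyMove_of_short (C : Config (dims c₁ c₂ n)) (m : Move (dims c₁ c₂ n))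
    (hm : m.axis = 2) {z : ℕ} (hz : z < n) : sliceOf (applyMove C m) z =
      if z = m.index then turnSlice m.turn (sliceOf C z) else sliceOf C z := by
  funext x y a s
  have hp := range_dims x.2 y.2 hz
  have h := colorAt_applyMove C m hp a s
  have hlt := rotatePos_lt m.inverse hp
  have e1 : m.inverse.axis = 2 := hm
  rw [e1, rotatePos_two] at hlt
  have h0 := hlt 0
  have h1 := hlt 1
  rw [hm, rotatePos_two] at h
  have e : (![(x : ℕ), y, z] : Fin 3 → ℕ) 2 = z := rfl
  rw [e] at h
  refine h.trans ?_
  split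
  · simp only [turnSlice]
    exact (get_sliceOf C z h0 h1 _ _).symm
  · rfl

/-- A half turn around a horizontal axis exchanges the heights z and n-1-z, so the new slice is
determined by the two mirror slices alone. -/
theorem sliceOf_applyMove_of_long (C : Config (dims c₁ c₂ n)) (m : Move (dims c₁ c₂ n))
    (ht : m.turn = Turn.half) (l : LongMove c₁ c₂)
    (hl : match l with
      | Sum.inl k => m.axis = 0 ∧ m.index = k.1
      | Sum.inr k => m.axis = 1 ∧ m.index = k.1) {z : ℕ} (hz : z < n) :
    sliceOf (applyMove C m) z = flipSlice l (sliceOf C z) (sliceOf C (n - 1 - z)) := by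
  funext x y a s
  have h := colorAt_applyMove C m (range_dims x.2 y.2 hz) a s
  rcases l with k | k
  · have e : rotatePos (dims c₁ c₂ n) 0 Turn.half ![(x : ℕ), y, z] =
        ![(x : ℕ), (y.rev : ℕ), n - 1 - z] := by
      funext e
      rcases fin3_cases e with rfl | rfl | rfl <;> (simp [rotatePos, Fin.val_rev]; try omega)
    rw [hl.1, hl.2, ht, Turn.inverse, e] at h
    refine h.trans ?_
    simp [flipSlice, rotateAxis, rotateSign, sliceOf, Fin.val_inj]
  · have e : rotatePos (dims c₁ c₂ n) 1 Turn.half ![(x : ℕ), y, z] =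
        ![(x.rev : ℕ), (y : ℕ), n - 1 - z] := by
      funext e
      rcases fin3_cases e with rfl | rfl | rfl <;> (simp [rotatePos, Fin.val_rev]; try omega)
    rw [hl.1, hl.2, ht, Turn.inverse, e] at h
    refine h.trans ?_
    simp [flipSlice, rotateAxis, rotateSign, sliceOf, Fin.val_inj]

/-- A slice has only colors that a cube with side colors `t` has. -/
def Slice.Good (t : Fin 3 × Bool → Color) (S : Slice c₁ c₂) : Prop :=
  ∀ x y a s c, S x y a s = some c → c = t (a, s)

/-- With the side colors fixed in advance, being solved is a condition on each slice separately;
this is why the target is part of a candidate. -/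
theorem solved_iff (C : Config (dims c₁ c₂ n)) :
    Solved C ↔ ∃ t : {t : Fin 3 × Bool → Color // Injective t},
      ∀ z < n, (sliceOf C z).Good t.1 := by
  constructor
  · rintro ⟨t, ht, h⟩
    refine ⟨⟨t, ht⟩, fun z hz x y a s c hc => ?_⟩
    rw [sliceOf, colorAt, Option.dite_none_right_eq_some] at hc
    obtain ⟨hv, hc⟩ := hc
    rw [← Option.some.inj hc]
    exact h _
  · rintro ⟨⟨t, ht⟩, h⟩
    refine ⟨t, ht, fun f => ?_⟩
    have h0 : f.pos 0 < c₁ := f.pos_lt 0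
    have h1 : f.pos 1 < c₂ := f.pos_lt 1
    refine h (f.pos 2) (f.pos_lt 2) ⟨f.pos 0, h0⟩ ⟨f.pos 1, h1⟩ f.axis f.positive _ ?_
    have e : ![f.pos 0, f.pos 1, f.pos 2] = f.pos := by
      funext e
      rcases fin3_cases e with rfl | rfl | rfl <;> rfl
    simp only [sliceOf, e, colorAt]
    rw [dif_pos ⟨f.pos_lt, f.visible⟩]

/-- A cluster consists of the only slice of the cube, of its middle slice, or of two slices. -/
inductive Kind
  | single
  | middle
  | pair
  deriving DecidableEq

instance : Fintype Kind :=
  ⟨{Kind.single, Kind.middle, Kind.pair}, fun k => by cases k <;> simp⟩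

/-- The kind of a cluster and its two slices, which are equal unless the kind is `pair`. -/
abbrev ClusterState (c₁ c₂ : ℕ) : Type := Kind × Slice c₁ c₂ × Slice c₁ c₂

/-- A short move of a cluster: which of the two slices it rotates, and how. -/
abbrev ShortMove (c₁ c₂ : ℕ) : Type := Bool × {t : Turn // t = Turn.half ↔ c₁ ≠ c₂}

/-- A cluster of one slice stores that slice twice, so both copies are turned, whichever of them the
move names. -/
def turnCluster (s : ShortMove c₁ c₂) (x : ClusterState c₁ c₂) : ClusterState c₁ c₂ :=
  match x.1, s.1 with
  | Kind.pair, false => (x.1, turnSlice s.2.1 x.2.1, x.2.2)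
  | Kind.pair, true => (x.1, x.2.1, turnSlice s.2.1 x.2.2)
  | _, _ => (x.1, turnSlice s.2.1 x.2.1, turnSlice s.2.1 x.2.2)

theorem turnCluster_fst (s : ShortMove c₁ c₂) (x : ClusterState c₁ c₂) :
    (turnCluster s x).1 = x.1 := by
  obtain ⟨k, a, b⟩ := x
  obtain ⟨u, t⟩ := s
  cases k <;> cases u <;> rfl

/-- The clusters of the `c₁ × c₂ × n` cubes. -/
def cubeSystem (c₁ c₂ : ℕ) : ClusterSystem (ClusterState c₁ c₂) (LongMove c₁ c₂)
    (ShortMove c₁ c₂) {t : Fin 3 × Bool → Color // Injective t} where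
  long l x := (x.1, flipSlice l x.2.1 x.2.2, flipSlice l x.2.2 x.2.1)
  short := turnCluster
  -- Only the cube of height 1 has a slice z = const that must not be turned.
  legal x := x.1 ≠ Kind.single
  good t x := x.2.1.Good t.1 ∧ x.2.2.Good t.1
  long_involutive l x := by simp [flipSlice_flipSlice]
  legal_long l x := Iff.rfl
  legal_short s x := by rw [turnCluster_fst]

def clusterKind (n i : ℕ) : Kind :=
  if 2 * i + 1 = n then if n = 1 then Kind.single else Kind.middle else Kind.pair

/-- The clusters of a configuration. -/
def clusters (C : Config (dims c₁ c₂ n)) (i : Fin ((n + 1) / 2)) : ClusterState c₁ c₂ :=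
  (clusterKind n i, sliceOf C i, sliceOf C (n - 1 - i))

/-- The move `m` of the cube is the move `a` of its clusters. -/
def Represents (m : Move (dims c₁ c₂ n)) :
    LongMove c₁ c₂ ⊕ (Fin ((n + 1) / 2) × ShortMove c₁ c₂) → Prop
  | Sum.inl (Sum.inl k) => m.axis = 0 ∧ m.index = k.1 ∧ m.turn = Turn.half
  | Sum.inl (Sum.inr k) => m.axis = 1 ∧ m.index = k.1 ∧ m.turn = Turn.half
  | Sum.inr (i, u, t) => m.axis = 2 ∧ m.index = (if u then n - 1 - i else i) ∧ m.turn = t.1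

/-- The slices of long moves have sizes c₂ × n and n × c₁. The hypotheses make them non-square, so
only half turns are legal. -/
theorem exists_represents (h₁ : c₁ ≠ n) (h₂ : n ≠ c₂) (m : Move (dims c₁ c₂ n)) :
    ∃ a, Represents m a ∧ ∀ i s, a = Sum.inr (i, s) → n ≠ 1 := by
  obtain ⟨a, k, t, hk, h1, ht⟩ := m
  rcases fin3_cases a with rfl | rfl | rfl
  · exact ⟨Sum.inl (Sum.inl ⟨⟨k, hk⟩, h1⟩), ⟨rfl, rfl, ht.2 h₂.symm⟩, by simp⟩
  · exact ⟨Sum.inl (Sum.inr ⟨⟨k, hk⟩, h1⟩), ⟨rfl, rfl, ht.2 h₁.symm⟩, by simp⟩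
  · have hk' : k < n := hk
    -- Slices of the lower half, including the middle one, are the first slices of their clusters,
    -- the others the second.
    by_cases h : k < (n + 1) / 2
    · exact ⟨Sum.inr (⟨k, h⟩, false, ⟨t, ht⟩), ⟨rfl, by simp, rfl⟩, fun _ _ _ => h1⟩
    · exact ⟨Sum.inr (⟨n - 1 - k, by omega⟩, true, ⟨t, ht⟩),
        ⟨rfl, by simp only [if_true]; omega, rfl⟩, fun _ _ _ => h1⟩

theorem exists_represented (h₁ : c₁ ≠ n) (h₂ : n ≠ c₂)
    (a : LongMove c₁ c₂ ⊕ (Fin ((n + 1) / 2) × ShortMove c₁ c₂))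
    (ha : ∀ i s, a = Sum.inr (i, s) → n ≠ 1) :
    ∃ m : Move (dims c₁ c₂ n), Represents m a := by
  rcases a with (k | k) | ⟨i, u, t⟩
  · exact ⟨⟨0, k.1, Turn.half, k.1.2, k.2, by simpa using h₂.symm⟩, rfl, rfl, rfl⟩
  · exact ⟨⟨1, k.1, Turn.half, k.1.2, k.2, by simpa using h₁.symm⟩, rfl, rfl, rfl⟩
  · refine ⟨⟨2, if u then n - 1 - i else i, t.1, ?_, ha _ _ rfl, t.2⟩, rfl, rfl, rfl⟩
    have := i.2
    change (if u then n - 1 - (i : ℕ) else i) < n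
    split <;> omega

theorem Represents.clusters_applyMove {m : Move (dims c₁ c₂ n)}
    {a : LongMove c₁ c₂ ⊕ (Fin ((n + 1) / 2) × ShortMove c₁ c₂)} (h : Represents m a)
    (C : Config (dims c₁ c₂ n)) :
    clusters (applyMove C m) = (cubeSystem c₁ c₂).famAct a (clusters C) := by
  have long : ∀ l : LongMove c₁ c₂, m.turn = Turn.half → (match l with
      | Sum.inl k => m.axis = 0 ∧ m.index = k.1
      | Sum.inr k => m.axis = 1 ∧ m.index = k.1) → clusters (applyMove C m) =
        (cubeSystem c₁ c₂).famAct (Sum.inl l) (clusters C) := by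
    intro l ht hl
    funext i
    have hi := i.2
    have e : n - 1 - (n - 1 - (i : ℕ)) = i := by omega
    simp only [clusters, ClusterSystem.famAct, cubeSystem]
    rw [sliceOf_applyMove_of_long C m ht l hl (by omega),
      sliceOf_applyMove_of_long C m ht l hl (by omega), e]
  rcases a with (k | k) | ⟨i, u, t⟩
  · exact long _ h.2.2 ⟨h.1, h.2.1⟩
  · exact long _ h.2.2 ⟨h.1, h.2.1⟩
  · obtain ⟨h1, h2, h3⟩ := h
    funext j
    have hi := i.2
    have hj := j.2
    have key : ∀ z < n, sliceOf (applyMove C m) z =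
        if z = (if u then n - 1 - (i : ℕ) else i) then turnSlice t (sliceOf C z)
        else sliceOf C z := by
      intro z hz
      rw [sliceOf_applyMove_of_short C m h1 hz, h2, h3]
    simp only [clusters, ClusterSystem.famAct, cubeSystem]
    rw [key j (by omega), key (n - 1 - j) (by omega)]
    by_cases hij : j = i
    · subst hij
      rw [update_self]
      -- In the middle the slice coincides with its mirror image, and both components must turn.
      by_cases hmid : 2 * (j : ℕ) + 1 = n
      · have e : n - 1 - (j : ℕ) = j := by omega
        have hk : clusterKind n j ≠ Kind.pair := by
          rw [clusterKind, if_pos hmid]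
          split <;> simp
        simp only [e, ite_self, if_true]
        generalize clusterKind n j = k at hk
        cases k <;> cases u <;> first | rfl | exact (hk rfl).elim
      · have hk : clusterKind n j = Kind.pair := by
          rw [clusterKind, if_neg hmid]
        have e : n - 1 - (j : ℕ) ≠ j := by omega
        rw [hk]
        cases u <;> simp [turnCluster, e, e.symm]
    -- The height sets {i, n-1-i} of different clusters are disjoint.
    · rw [update_of_ne hij]
      have hij' : (j : ℕ) ≠ i := fun h => hij (Fin.ext h)
      have e1 : (j : ℕ) ≠ if u then n - 1 - (i : ℕ) else i := by split <;> omega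
      have e2 : n - 1 - (j : ℕ) ≠ if u then n - 1 - (i : ℕ) else i := by split <;> omega
      rw [if_neg e1, if_neg e2]
      rfl

theorem clusters_foldl {s : List (Move (dims c₁ c₂ n))}
    {u : List (LongMove c₁ c₂ ⊕ (Fin ((n + 1) / 2) × ShortMove c₁ c₂))}
    (h : List.Forall₂ Represents s u) (C : Config (dims c₁ c₂ n)) :
    clusters (s.foldl applyMove C) = (cubeSystem c₁ c₂).famRun u (clusters C) := by
  induction h generalizing C with
  | nil => rfl
  | cons h _ ih =>
    rw [List.foldl_cons, ih, h.clusters_applyMove]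
    rfl

theorem solved_iff_clusters (C : Config (dims c₁ c₂ n)) :
    Solved C ↔ ∃ t, ∀ i, (cubeSystem c₁ c₂).good t (clusters C i) := by
  rw [solved_iff]
  refine exists_congr fun t => ⟨fun h i => ?_, fun h z hz => ?_⟩
  · have hi := i.2
    exact ⟨h _ (by omega), h _ (by omega)⟩
  · by_cases hz' : z < (n + 1) / 2
    · exact (h ⟨z, hz'⟩).1
    · have e : z = n - 1 - (n - 1 - z) := by omega
      rw [e]
      exact (h ⟨n - 1 - z, by omega⟩).2

theorem legal_clusters (C : Config (dims c₁ c₂ n)) (i : Fin ((n + 1) / 2)) :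
    (cubeSystem c₁ c₂).legal (clusters C i) ↔ n ≠ 1 := by
  have hi := i.2
  simp only [cubeSystem, clusters, clusterKind]
  by_cases hn : n = 1
  · subst hn
    have : (i : ℕ) = 0 := by omega
    simp
  · split <;> simp [hn]

/-- The translation goes move by move, so that lengths and the counts of long moves and of short
moves per cluster are preserved. -/
theorem exists_famSolves (h₁ : c₁ ≠ n) (h₂ : n ≠ c₂) {C : Config (dims c₁ c₂ n)}
    {s : List (Move (dims c₁ c₂ n))} (h : IsSolution C s) :
    ∃ u, List.Forall₂ Represents s u ∧ (cubeSystem c₁ c₂).FamSolves u (clusters C) := by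
  have key : ∀ s : List (Move (dims c₁ c₂ n)), ∃ u, List.Forall₂ Represents s u ∧
      ∀ i s, Sum.inr (i, s) ∈ u → n ≠ 1 := by
    intro s
    induction s with
    | nil => exact ⟨[], .nil, by simp⟩
    | cons m s ih =>
      obtain ⟨u, hu, hu'⟩ := ih
      obtain ⟨a, ha, ha'⟩ := exists_represents h₁ h₂ m
      refine ⟨a :: u, .cons ha hu, fun i s h => ?_⟩
      rcases List.mem_cons.1 h with h | h
      · exact ha' i s h.symm
      · exact hu' i s h
  obtain ⟨u, hu, hu'⟩ := key s
  refine ⟨u, hu, fun i s h => (legal_clusters C i).2 (hu' i s h), ?_⟩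
  rw [IsSolution, solved_iff_clusters, clusters_foldl hu] at h
  exact h

theorem ClusterSystem.FamSolves.exists_isSolution (h₁ : c₁ ≠ n) (h₂ : n ≠ c₂)
    {C : Config (dims c₁ c₂ n)}
    {u : List (LongMove c₁ c₂ ⊕ (Fin ((n + 1) / 2) × ShortMove c₁ c₂))}
    (h : (cubeSystem c₁ c₂).FamSolves u (clusters C)) :
    ∃ s, List.Forall₂ Represents s u ∧ IsSolution C s := by
  have key : ∀ u : List (LongMove c₁ c₂ ⊕ (Fin ((n + 1) / 2) × ShortMove c₁ c₂)),
      (∀ i s, Sum.inr (i, s) ∈ u → n ≠ 1) →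
      ∃ s : List (Move (dims c₁ c₂ n)), List.Forall₂ Represents s u := by
    intro u hu
    induction u with
    | nil => exact ⟨[], .nil⟩
    | cons a u ih =>
      obtain ⟨s, hs⟩ := ih fun i s h => hu i s (List.mem_cons_of_mem _ h)
      obtain ⟨m, hm⟩ := exists_represented h₁ h₂ a fun i s h => hu i s (h ▸ List.mem_cons_self)
      exact ⟨m :: s, .cons hm hs⟩
  obtain ⟨s, hs⟩ := key u fun i s hi => (legal_clusters C i).1 (h.1 i s hi)
  refine ⟨s, hs, ?_⟩
  rw [IsSolution, solved_iff_clusters, clusters_foldl hs]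
  exact h.2

theorem longMoves_eq {s : List (Move (dims c₁ c₂ n))}
    {u : List (LongMove c₁ c₂ ⊕ (Fin ((n + 1) / 2) × ShortMove c₁ c₂))}
    (h : List.Forall₂ Represents s u) : longMoves s = (longs u).length := by
  induction h with
  | nil => rfl
  | @cons m a s u h _ ih =>
    simp only [longMoves, Move.IsShort] at ih ⊢
    rcases a with (k | k) | ⟨i, u, t⟩ <;>
      simp [ih, h.1]

theorem shortMoves_eq {s : List (Move (dims c₁ c₂ n))}
    {u : List (LongMove c₁ c₂ ⊕ (Fin ((n + 1) / 2) × ShortMove c₁ c₂))}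
    (h : List.Forall₂ Represents s u) {z : ℕ} (hz : z < n) {i : Fin ((n + 1) / 2)}
    (hi : (i : ℕ) = z ∨ (i : ℕ) = n - 1 - z) : shortMoves z s = cost (proj i u) := by
  induction h with
  | nil => rfl
  | @cons m a s u h _ ih =>
    simp only [shortMoves, Move.IsShort] at ih ⊢
    rcases a with (k | k) | ⟨j, b, t⟩
    · simpa [List.countP_cons, h.1] using ih
    · simpa [List.countP_cons, h.1] using ih
    · obtain ⟨e1, e2, -⟩ := h
      have hj := j.2
      have hi' := i.2
      have e : (m.index = z ∨ m.index = n - 1 - z) ↔ j = i := by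
        rw [e2, Fin.ext_iff]
        cases b <;> simp <;> omega
      rw [List.countP_cons, ih, proj_inr]
      have e3 : dims c₁ c₂ n 2 = n := rfl
      simp only [e1, e3, e, true_and]
      by_cases hji : j = i <;> simp [hji]

/-! ### Slices as blocks of the input word -/

/-- The symbols of a slice in the encoding of a configuration. -/
def encodeSlice (S : Slice c₁ c₂) : List (Option Color) :=
  (List.range c₁).flatMap fun x => (List.range c₂).flatMap fun y =>
    (List.finRange 3).flatMap fun a => [false, true].map fun s => S.get x y a s

theorem flatMap_congr_of_mem {α β : Type} {l : List α} {f g : α → List β}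
    (h : ∀ a ∈ l, f a = g a) : l.flatMap f = l.flatMap g := by
  induction l with
  | nil => rfl
  | cons a l ih =>
    rw [List.flatMap_cons, List.flatMap_cons, h a List.mem_cons_self,
      ih fun b hb => h b (List.mem_cons_of_mem _ hb)]

theorem encodeConfig_eq (C : Config (dims c₁ c₂ n)) :
    encodeConfig C = (List.range n).flatMap fun z => encodeSlice (sliceOf C z) := by
  refine flatMap_congr_of_mem fun z _ => flatMap_congr_of_mem fun x hx =>
    flatMap_congr_of_mem fun y hy => flatMap_congr_of_mem fun a _ => ?_
  refine List.map_congr_left fun s _ => ?_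
  rw [get_sliceOf C z (List.mem_range.1 hx) (List.mem_range.1 hy)]

theorem eq_of_flatMap_eq {α β : Type} {l : List α} {f g : α → List β} {m : ℕ}
    (hf : ∀ a, (f a).length = m) (hg : ∀ a, (g a).length = m) (h : l.flatMap f = l.flatMap g) :
    ∀ a ∈ l, f a = g a := by
  induction l with
  | nil => simp
  | cons a l ih =>
    rw [List.flatMap_cons, List.flatMap_cons] at h
    obtain ⟨h1, h2⟩ := List.append_inj h ((hf a).trans (hg a).symm)
    intro b hb
    rcases List.mem_cons.1 hb with rfl | hb
    · exact h1
    · exact ih h2 b hb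

theorem length_flatMap_const {α β : Type} (l : List α) {f : α → List β} {m : ℕ}
    (hf : ∀ a, (f a).length = m) : (l.flatMap f).length = l.length * m := by
  simp [List.length_flatMap, hf]

theorem length_encodeSlice (S : Slice c₁ c₂) : (encodeSlice S).length = c₁ * (c₂ * 6) := by
  rw [encodeSlice, length_flatMap_const, List.length_range]
  intro x
  rw [length_flatMap_const, List.length_range]
  intro y
  rfl

/-- On each level the blocks have a fixed length, so equal words have equal blocks. This allows the
machine to decode by `invFun`. -/
theorem encodeSlice_injective : Injective (encodeSlice : Slice c₁ c₂ → List (Option Color)) := by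
  intro S S' h
  funext x y a s
  have h := eq_of_flatMap_eq (m := c₂ * 6) (fun x => ?_) (fun x => ?_) h x (List.mem_range.2 x.2)
  · have h := eq_of_flatMap_eq (m := 6) (fun y => rfl) (fun y => rfl) h y (List.mem_range.2 y.2)
    have h := eq_of_flatMap_eq (m := 2) (fun y => rfl) (fun y => rfl) h a (List.mem_finRange a)
    have h := List.map_inj_left.1 h s (by simp)
    simpa [Slice.get] using h
  · rw [length_flatMap_const, List.length_range]
    exact fun y => rfl
  · rw [length_flatMap_const, List.length_range]
    exact fun y => rfl

end RubikCube

/-! ### Stack machines and their compilation to `Turing.FinTM2` -/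

namespace RubikCube
open Function

/-- A machine that in each step pops the top symbol of each of its stacks and pushes a list
of symbols onto each of them, controlled by a finite number of states. -/
structure StackMachine (K : Type) (Γ : K → Type) (Q : Type) where
  input : K
  output : K
  start : Q
  halted : Q → Bool
  next : Q → (∀ k, Option (Γ k)) → Q
  push : Q → (∀ k, Option (Γ k)) → ∀ k, List (Γ k)

namespace StackMachine
variable {K : Type} {Γ : K → Type} {Q : Type} (M : StackMachine K Γ Q)

/-- The configuration after one step. -/
def stepTo (c : Q × ∀ k, List (Γ k)) : Q × ∀ k, List (Γ k) :=
  (M.next c.1 fun k => (c.2 k).head?,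
    fun k => M.push c.1 (fun k => (c.2 k).head?) k ++ (c.2 k).tail)

/-- The machine gets from the first to the second configuration in at most `T` steps. -/
inductive Runs : ℕ → (Q × ∀ k, List (Γ k)) → (Q × ∀ k, List (Γ k)) → Prop
  | refl (T : ℕ) (c : Q × ∀ k, List (Γ k)) : Runs T c c
  | step {T : ℕ} {c c' : Q × ∀ k, List (Γ k)} (hc : M.halted c.1 = false)
      (h : Runs T (M.stepTo c) c') : Runs (T + 1) c c'

variable {M}

theorem Runs.mono {T T' : ℕ} {c c' : Q × ∀ k, List (Γ k)} (h : M.Runs T c c') (hT : T ≤ T') :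
    M.Runs T' c c' := by
  induction h generalizing T' with
  | refl => exact .refl _ _
  | step hc h ih =>
    obtain ⟨T', rfl⟩ : ∃ T'', T' = T'' + 1 := ⟨T' - 1, by omega⟩
    exact .step hc (ih (by omega))

theorem Runs.trans {T T' : ℕ} {c c' c'' : Q × ∀ k, List (Γ k)} (h : M.Runs T c c')
    (h' : M.Runs T' c' c'') : M.Runs (T + T') c c'' := by
  induction h with
  | refl => exact h'.mono (by omega)
  | @step T _ _ hc h ih =>
    rw [show T + 1 + T' = T + T' + 1 by omega]
    exact .step hc (ih h')

variable (M)

section Compile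
open Turing Turing.TM2 Turing.TM2.Stmt
variable [DecidableEq K]

/-- Pop the stacks in the list and remember their top symbols. -/
def popAll (s : Stmt Γ Unit (Q × ∀ k, Option (Γ k))) :
    List K → Stmt Γ Unit (Q × ∀ k, Option (Γ k))
  | [] => s
  | k :: ks => Stmt.pop k (fun v o => (v.1, update v.2 k o)) (popAll s ks)

theorem stepAux_popAll (s : Stmt Γ Unit (Q × ∀ k, Option (Γ k))) {ks : List K} (hk : ks.Nodup)
    (v : Q × ∀ k, Option (Γ k)) (S : ∀ k, List (Γ k)) :
    stepAux (popAll s ks) v S =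
      stepAux s (v.1, fun k => if k ∈ ks then (S k).head? else v.2 k)
        (fun k => if k ∈ ks then (S k).tail else S k) := by
  induction ks generalizing v S with
  | nil => simp [popAll]
  | cons j ks ih =>
    rw [List.nodup_cons] at hk
    rw [popAll, stepAux, ih hk.2]
    congr 1
    · congr 1
      funext k
      by_cases h : k = j
      · subst h
        simp [hk.1]
      · simp [h]
    · funext k
      by_cases h : k = j
      · subst h
        simp [hk.1]
      · simp [h]

variable [∀ k, Inhabited (Γ k)]

/-- Push the first `i` symbols that are due on stack `k`. -/
def pushOne (s : Stmt Γ Unit (Q × ∀ k, Option (Γ k))) (k : K) :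
    ℕ → Stmt Γ Unit (Q × ∀ k, Option (Γ k))
  | 0 => s
  | i + 1 => Stmt.branch (fun v => i < (M.push v.1 v.2 k).length)
      (Stmt.push k (fun v => (M.push v.1 v.2 k).getD i default) (pushOne s k i))
      (pushOne s k i)

/-- A statement has a fixed number of pushes, whereas the number of symbols due varies; hence one
branch per possible symbol. Pushing from the last symbol to the first leaves the head of the list on
top, and the guard ensures that `default` is never pushed. -/
theorem stepAux_pushOne (s : Stmt Γ Unit (Q × ∀ k, Option (Γ k))) (k : K) (i : ℕ)
    (v : Q × ∀ k, Option (Γ k)) (S : ∀ k, List (Γ k)) :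
    stepAux (M.pushOne s k i) v S =
      stepAux s v (update S k ((M.push v.1 v.2 k).take i ++ S k)) := by
  induction i generalizing S with
  | zero => simp [pushOne]
  | succ i ih =>
    rw [pushOne, stepAux]
    by_cases h : i < (M.push v.1 v.2 k).length
    · simp only [h, decide_true, cond_true]
      have e : (M.push v.1 v.2 k).take (i + 1) =
          (M.push v.1 v.2 k).take i ++ [(M.push v.1 v.2 k).getD i default] := by
        rw [List.take_add_one, List.getElem?_eq_getElem h, List.getD_eq_getElem _ _ h]
        rfl
      rw [stepAux, ih, e, update_idem, update_self, List.append_assoc]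
      rfl
    · simp only [h, decide_false, cond_false]
      rw [ih, List.take_of_length_le (by omega), List.take_of_length_le (by omega)]

/-- Push what is due on the stacks in the list, at most `r` symbols on each. -/
def pushAll (r : ℕ) (s : Stmt Γ Unit (Q × ∀ k, Option (Γ k))) :
    List K → Stmt Γ Unit (Q × ∀ k, Option (Γ k))
  | [] => s
  | k :: ks => M.pushOne (pushAll r s ks) k r

theorem stepAux_pushAll (r : ℕ) (s : Stmt Γ Unit (Q × ∀ k, Option (Γ k))) {ks : List K}
    (hk : ks.Nodup) (v : Q × ∀ k, Option (Γ k)) (S : ∀ k, List (Γ k)) :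
    stepAux (M.pushAll r s ks) v S = stepAux s v
      (fun k => if k ∈ ks then (M.push v.1 v.2 k).take r ++ S k else S k) := by
  induction ks generalizing S with
  | nil => simp [pushAll]
  | cons j ks ih =>
    rw [List.nodup_cons] at hk
    rw [pushAll, stepAux_pushOne, ih hk.2]
    congr 1
    funext k
    by_cases h : k = j
    · subst h
      simp [hk.1]
    · simp [h]

end Compile

section
variable [Fintype K] [Fintype Q] [∀ k, Fintype (Γ k)]

/-- The control is finite. The bound fixes the size of `program`, and it later limits the growth of
the stacks. -/
theorem exists_push_bound : ∃ r, ∀ q tops k, (M.push q tops k).length ≤ r := by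
  classical
  obtain ⟨r, hr⟩ := (Set.finite_range
    fun x : Q × (∀ k, Option (Γ k)) × K => (M.push x.1 x.2.1 x.2.2).length).bddAbove
  exact ⟨r, fun q tops k => hr ⟨(q, tops, k), rfl⟩⟩

end

variable [Fintype K] [Fintype Q] [∀ k, Fintype (Γ k)] [∀ k, Inhabited (Γ k)]

/-- The program of the machine. -/
noncomputable def program [DecidableEq K] : Turing.TM2.Stmt Γ Unit (Q × ∀ k, Option (Γ k)) :=
  open Turing.TM2.Stmt in
  -- The memory is reset before halting, since `Turing.haltList` requires the initial memory.
  branch (fun v => M.halted v.1) (load (fun _ => (M.start, fun _ => none)) halt)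
    (popAll (M.pushAll M.exists_push_bound.choose
      (load (fun v => (M.next v.1 v.2, fun _ => none)) (goto fun _ => ()))
        (Finset.univ : Finset K).toList) (Finset.univ : Finset K).toList)

theorem stepAux_program [DecidableEq K] (c : Q × ∀ k, List (Γ k)) (hc : M.halted c.1 = false) :
    Turing.TM2.stepAux M.program (c.1, fun _ => none) c.2 =
      ⟨some (), ((M.stepTo c).1, fun _ => none), (M.stepTo c).2⟩ := by
  rw [program, Turing.TM2.stepAux, hc, cond_false, stepAux_popAll _ (Finset.nodup_toList _),
    stepAux_pushAll _ _ _ (Finset.nodup_toList _)]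
  simp only [Finset.mem_toList, Finset.mem_univ, if_true, Turing.TM2.stepAux, stepTo]
  congr 1
  funext k
  rw [List.take_of_length_le (M.exists_push_bound.choose_spec _ _ _)]

theorem stepAux_program_of_halted [DecidableEq K] (c : Q × ∀ k, List (Γ k))
    (hc : M.halted c.1 = true) : Turing.TM2.stepAux M.program (c.1, fun _ => none) c.2 =
      ⟨none, (M.start, fun _ => none), c.2⟩ := by
  rw [program, Turing.TM2.stepAux, hc, cond_true]
  rfl

/-- The machine as a multi-stack Turing machine. -/
noncomputable def toFinTM2 : Turing.FinTM2 :=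
  open Classical in
  { K := K
    k₀ := M.input
    k₁ := M.output
    Γ := Γ
    Λ := Unit
    main := ()
    σ := Q × ∀ k, Option (Γ k)
    initialState := (M.start, fun _ => none)
    m := fun _ => M.program }

/-- A configuration of the machine as one of the Turing machine. -/
def toCfg (c : Q × ∀ k, List (Γ k)) : M.toFinTM2.Cfg :=
  ⟨some (), (c.1, fun _ => none), c.2⟩

theorem step_toCfg (c : Q × ∀ k, List (Γ k)) (hc : M.halted c.1 = false) :
    M.toFinTM2.step (M.toCfg c) = some (M.toCfg (M.stepTo c)) := by
  classical
  exact congrArg some (M.stepAux_program c hc)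

variable {M}

theorem Runs.iterate_step {T : ℕ} {c c' : Q × ∀ k, List (Γ k)} (h : M.Runs T c c') :
    ∃ t ≤ T, (flip bind M.toFinTM2.step)^[t] (some (M.toCfg c)) = some (M.toCfg c') := by
  induction h with
  | refl T c => exact ⟨0, T.zero_le, rfl⟩
  | step hc h ih =>
    obtain ⟨t, ht, e⟩ := ih
    refine ⟨t + 1, by omega, ?_⟩
    rw [iterate_succ_apply, ← e]
    congr 1
    exact M.step_toCfg _ hc

theorem Runs.outputs {T : ℕ} {stk stk' : ∀ k, List (Γ k)} {q : Q}
    (h : M.Runs T (M.start, stk) (q, stk')) (hq : M.halted q = true)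
    (hin : ∀ k, k ≠ M.input → stk k = []) (hout : ∀ k, k ≠ M.output → stk' k = []) :
    Nonempty (Turing.TM2OutputsInTime M.toFinTM2 (stk M.input) (some (stk' M.output))
      (T + 1)) := by
  obtain ⟨t, ht, e⟩ := h.iterate_step
  have e1 : Turing.initList M.toFinTM2 (stk M.input) = M.toCfg (M.start, stk) := by
    simp only [Turing.initList, toCfg]
    congr 1
    funext k
    by_cases hk : k = M.input
    · subst hk
      exact dif_pos rfl
    · exact (dif_neg hk).trans (hin k hk).symm
  have e2 : Turing.haltList M.toFinTM2 (stk' M.output) =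
      ⟨none, (M.start, fun _ => none), stk'⟩ := by
    simp only [Turing.haltList]
    congr 1
    funext k
    by_cases hk : k = M.output
    · subst hk
      exact dif_pos rfl
    · exact (dif_neg hk).trans (hout k hk).symm
  have e3 : M.toFinTM2.step (M.toCfg (q, stk')) = some ⟨none, (M.start, fun _ => none), stk'⟩ := by
    classical
    exact congrArg some (M.stepAux_program_of_halted (q, stk') hq)
  -- The additional step executes the halting branch.
  refine ⟨⟨⟨t + 1, ?_⟩, Nat.add_le_add_right ht 1⟩⟩
  rw [iterate_succ_apply', e1, e]
  exact e3.trans (congrArg some e2.symm)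

end StackMachine
end RubikCube

/-! ### The solving machine -/

namespace RubikCube
open Function

/-- What the solving machine knows about the finitely many candidates `e : E` for the target and
the sequence of long moves: the codes of the long moves, and for each cluster whether it can be
solved, the number of short moves that it takes, and these moves. -/
structure SolverData (A E : Type) where
  blockLength : ℕ
  decode : List (Option Color) → A
  maxLong : ℕ
  numLong : E → Fin (maxLong + 1)
  longCode : E → ℕ → List OutSym
  feasible : E → Kind × A × A → Bool
  cost : E → Kind × A × A → ℕ
  moves : E → ℕ → Kind × A × A → List (Bool × Turn)

/-- The stacks of the solving machine. -/
inductive Stack (E : Type) (J : ℕ)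
  | inp
  | out
  | left
  | right
  | half
  | count (e : E)
  | tokens (e : E) (j : Fin (J + 1))
  | ticks (u : Bool)
  | temp

/-- The alphabets of the stacks. -/
def Alphabet (A E : Type) (J : ℕ) : Stack E J → Type
  | .inp => Option Color
  | .out => OutSym
  | .left => A
  | .right => A
  | .tokens _ _ => Option (Bool × Turn)
  | _ => Unit

/-- The states of the solving machine. -/
inductive State (b : ℕ) (E : Type) (J : ℕ)
  | read (buf : {l : List (Option Color) // l.length ≤ b}) (odd : Bool)
  | split (odd : Bool)
  | middle
  | pair (f : E → Bool)
  | compare (f : E → Bool)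
  | tokens (e : E) (j : Fin (J + 1))
  | emit (e : E) (j : Fin (J + 1)) (u : Bool)
  | restore (e : E) (j : Fin (J + 1)) (u : Bool)
  | reset (e : E) (j : Fin (J + 1))
  | clean
  | done

section Finiteness
variable (A E : Type) (b J : ℕ)

instance : Finite Turn :=
  Finite.of_surjective (fun i : Fin 3 => ![Turn.ccw, Turn.cw, Turn.half] i) fun t => by
    cases t
    exacts [⟨0, rfl⟩, ⟨1, rfl⟩, ⟨2, rfl⟩]

instance : Finite OutSym :=
  Finite.of_surjective (fun x : Fin 3 ⊕ Turn ⊕ Bool => match x with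
    | Sum.inl a => OutSym.axis a
    | Sum.inr (Sum.inl t) => OutSym.turn t
    | Sum.inr (Sum.inr b) => if b then OutSym.tick else OutSym.unsolvable) fun s => by
    cases s with
    | axis a => exact ⟨Sum.inl a, rfl⟩
    | tick => exact ⟨Sum.inr (Sum.inr true), rfl⟩
    | turn t => exact ⟨Sum.inr (Sum.inl t), rfl⟩
    | unsolvable => exact ⟨Sum.inr (Sum.inr false), rfl⟩

instance [Finite E] : Finite (Stack E J) :=
  Finite.of_surjective (fun x : Fin 6 ⊕ E ⊕ (E × Fin (J + 1)) ⊕ Bool => match x with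
    | Sum.inl a => ![Stack.inp, Stack.out, Stack.left, Stack.right, Stack.half, Stack.temp] a
    | Sum.inr (Sum.inl e) => Stack.count e
    | Sum.inr (Sum.inr (Sum.inl (e, j))) => Stack.tokens e j
    | Sum.inr (Sum.inr (Sum.inr u)) => Stack.ticks u) fun s => by
    cases s with
    | inp => exact ⟨Sum.inl 0, rfl⟩
    | out => exact ⟨Sum.inl 1, rfl⟩
    | left => exact ⟨Sum.inl 2, rfl⟩
    | right => exact ⟨Sum.inl 3, rfl⟩
    | half => exact ⟨Sum.inl 4, rfl⟩
    | temp => exact ⟨Sum.inl 5, rfl⟩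
    | count e => exact ⟨Sum.inr (Sum.inl e), rfl⟩
    | tokens e j => exact ⟨Sum.inr (Sum.inr (Sum.inl (e, j))), rfl⟩
    | ticks u => exact ⟨Sum.inr (Sum.inr (Sum.inr u)), rfl⟩

instance [Finite A] (k : Stack E J) : Finite (Alphabet A E J k) := by
  cases k <;> unfold Alphabet <;> infer_instance

instance [Inhabited A] (k : Stack E J) : Inhabited (Alphabet A E J k) := by
  cases k <;> unfold Alphabet
  case out => exact ⟨OutSym.tick⟩
  all_goals infer_instance

instance : Finite {l : List (Option Color) // l.length ≤ b} :=
  (List.finite_length_le _ b).to_subtype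

instance [Finite E] : Finite (State b E J) :=
  Finite.of_surjective (fun x : ({l : List (Option Color) // l.length ≤ b} × Bool) ⊕ Bool ⊕
      (Bool × (E → Bool)) ⊕ (E × Fin (J + 1) × Fin 2) ⊕ (E × Fin (J + 1) × Bool × Bool) ⊕
      Fin 3 => match x with
    | Sum.inl (l, o) => State.read l o
    | Sum.inr (Sum.inl o) => State.split o
    | Sum.inr (Sum.inr (Sum.inl (o, f))) => if o then State.pair f else State.compare f
    | Sum.inr (Sum.inr (Sum.inr (Sum.inl (e, j, o)))) => ![State.tokens e j, State.reset e j] o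
    | Sum.inr (Sum.inr (Sum.inr (Sum.inr (Sum.inl (e, j, u, o))))) =>
        if o then State.emit e j u else State.restore e j u
    | Sum.inr (Sum.inr (Sum.inr (Sum.inr (Sum.inr i)))) =>
        ![State.middle, State.clean, State.done] i) fun s => by
    cases s with
    | read l o => exact ⟨Sum.inl (l, o), rfl⟩
    | split o => exact ⟨Sum.inr (Sum.inl o), rfl⟩
    | middle => exact ⟨Sum.inr (Sum.inr (Sum.inr (Sum.inr (Sum.inr 0)))), rfl⟩
    | pair f => exact ⟨Sum.inr (Sum.inr (Sum.inl (true, f))), rfl⟩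
    | compare f => exact ⟨Sum.inr (Sum.inr (Sum.inl (false, f))), rfl⟩
    | tokens e j => exact ⟨Sum.inr (Sum.inr (Sum.inr (Sum.inl (e, j, 0)))), rfl⟩
    | reset e j => exact ⟨Sum.inr (Sum.inr (Sum.inr (Sum.inl (e, j, 1)))), rfl⟩
    | emit e j u => exact ⟨Sum.inr (Sum.inr (Sum.inr (Sum.inr (Sum.inl (e, j, u, true))))), rfl⟩
    | restore e j u =>
      exact ⟨Sum.inr (Sum.inr (Sum.inr (Sum.inr (Sum.inl (e, j, u, false))))), rfl⟩
    | clean => exact ⟨Sum.inr (Sum.inr (Sum.inr (Sum.inr (Sum.inr 1)))), rfl⟩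
    | done => exact ⟨Sum.inr (Sum.inr (Sum.inr (Sum.inr (Sum.inr 2)))), rfl⟩

end Finiteness

namespace SolverData
variable {A E : Type} (P : SolverData A E)

abbrev Tops : Type := ∀ k, Option (Alphabet A E P.maxLong k)

abbrev Pushes : Type := ∀ k, List (Alphabet A E P.maxLong k)

/-- Push the top symbols back. -/
def keep (tops : P.Tops) : P.Pushes := fun k => (tops k).toList

/-- Push the top symbol back, and more symbols on top of it. -/
def keepWith (tops : P.Tops) (k : Stack E P.maxLong) (l : List (Alphabet A E P.maxLong k)) :
    List (Alphabet A E P.maxLong k) := l ++ (tops k).toList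

/-- The next state of the solving machine, and what is pushed onto the stacks other than the
popped symbols. -/
noncomputable def trans [DecidableEq E] (q : State P.blockLength E P.maxLong) (tops : P.Tops) :
    State P.blockLength E P.maxLong × P.Pushes :=
  open Classical in
  match q with
  -- Each complete block becomes a slice on `left`, so the last slice ends on top. `ticks true`
  -- counts the slices and `half` every second one.
  | .read buf odd =>
    match tops .inp with
    | none => (.split odd, P.keep tops)
    | some c =>
      if h : buf.1.length + 1 < P.blockLength then
        (.read ⟨buf.1 ++ ([c] : List (Option Color)), by rw [List.length_append]; exact h.le⟩ odd, fun
          | .inp => []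
          | k => P.keep tops k)
      else
        (.read ⟨[], Nat.zero_le _⟩ !odd, fun
          | .inp => []
          | .left => P.decode (buf.1 ++ ([c] : List (Option Color))) :: P.keep tops .left
          | .half => if odd then () :: P.keep tops .half else P.keep tops .half
          | .ticks true => () :: P.keep tops (.ticks true)
          | k => P.keep tops k)
  -- Moving the upper n/2 slices to `right` reverses them, so that, apart from a middle slice, the
  -- tops of `left` and `right` are mirror slices.
  | .split odd =>
    match tops .half, tops .left with
    | some _, some a => (.split odd, fun
        | .half => []
        | .left => []
        | .right => a :: P.keep tops .right
        | k => P.keep tops k)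
    | _, _ => (if odd then .middle else .pair fun _ => true, P.keep tops)
  -- For odd n the middle slice is now on top of `left`; `right` is empty exactly if n = 1.
  | .middle =>
    match tops .left with
    | some a =>
      let x : Kind × A × A := (if (tops .right).isNone then Kind.single else Kind.middle, a, a)
      (.pair fun e => P.feasible e x, fun
        | .left => []
        | .count e => P.keepWith tops (.count e) (List.replicate (P.cost e x) ())
        | .tokens e j => P.keepWith tops (.tokens e j) ((P.moves e j x).reverse.map some ++ [none])
        | k => P.keep tops k)
    | none => (.done, P.keep tops)
  | .pair f =>
    match tops .left, tops .right with
    | some a, some b =>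
      let x : Kind × A × A := (Kind.pair, a, b)
      (.pair fun e => f e && P.feasible e x, fun
        | .left => []
        | .right => []
        | .count e => P.keepWith tops (.count e) (List.replicate (P.cost e x) ())
        | .tokens e j => P.keepWith tops (.tokens e j) ((P.moves e j x).reverse.map some ++ [none])
        | k => P.keep tops k)
    | _, _ => (.compare f, fun
        | .count e => P.keepWith tops (.count e) (List.replicate (P.numLong e) ())
        | k => P.keep tops k)
  -- All counters decrease together; the first one of a feasible candidate to be empty belongs to a
  -- cheapest candidate.
  | .compare f =>
    if h : ∃ e, f e = true ∧ (tops (.count e)).isNone then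
      (.tokens h.choose (P.numLong h.choose), P.keep tops)
    else if ∃ e, f e = true then
      (.compare f, fun
        | .count _ => []
        | k => P.keep tops k)
    else (.clean, fun
        | .out => OutSym.unsolvable :: P.keep tops .out
        | k => P.keep tops k)
  -- The output is a stack, so the answer is printed backwards. The token `none` ends a cluster; in
  -- cluster i the tick stacks have heights i and n-i.
  | .tokens e j =>
    match tops (.tokens e j) with
    | none => (.reset e j, P.keep tops)
    | some none => (.tokens e j, fun
        | .tokens e' j' => if e' = e ∧ j' = j then [] else P.keep tops (.tokens e' j')
        | .ticks false => () :: P.keep tops (.ticks false)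
        | .ticks true => []
        | k => P.keep tops k)
    | some (some (u, t)) => (.emit e j u, fun
        | .tokens e' j' => if e' = e ∧ j' = j then [] else P.keep tops (.tokens e' j')
        | .out => OutSym.turn t :: P.keep tops .out
        -- The mirror slice has index n-1-i, one less than the height of this stack, so one tick is
        -- set aside in `temp`.
        | .ticks true => if u then [] else P.keep tops (.ticks true)
        | .temp => if u then () :: P.keep tops .temp else P.keep tops .temp
        | k => P.keep tops k)
  | .emit e j u =>
    match tops (.ticks u) with
    | some _ => (.emit e j u, fun
        | .ticks u' => if u' = u then [] else P.keep tops (.ticks u')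
        | .temp => () :: P.keep tops .temp
        | .out => OutSym.tick :: P.keep tops .out
        | k => P.keep tops k)
    | none => (.restore e j u, fun
        | .out => OutSym.axis 2 :: P.keep tops .out
        | k => P.keep tops k)
  | .restore e j u =>
    match tops .temp with
    | some _ => (.restore e j u, fun
        | .ticks u' => if u' = u then () :: P.keep tops (.ticks u') else P.keep tops (.ticks u')
        | .temp => []
        | k => P.keep tops k)
    | none => (.tokens e j, P.keep tops)
  | .reset e j =>
    match tops (.ticks false) with
    | some _ => (.reset e j, fun
        | .ticks false => []
        | .ticks true => () :: P.keep tops (.ticks true)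
        | k => P.keep tops k)
    | none =>
      if (j : ℕ) = 0 then (.clean, P.keep tops)
      else (.tokens e ⟨j - 1, by omega⟩, fun
        | .out => P.keepWith tops .out (P.longCode e (j - 1))
        | k => P.keep tops k)
  -- A `Turing.FinTM2` must end with all stacks but the output empty.
  | .clean =>
    (if ∀ k, k ≠ .out → tops k = none then .done else .clean, fun
      | .out => P.keep tops .out
      | _ => [])
  | .done => (.done, P.keep tops)

/-- The solving machine. -/
noncomputable def machine [DecidableEq E] :
    StackMachine (Stack E P.maxLong) (Alphabet A E P.maxLong)
      (State P.blockLength E P.maxLong) where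
  input := .inp
  output := .out
  start := .read ⟨[], Nat.zero_le _⟩ false
  halted
    | .done => true
    | _ => false
  next q tops := (P.trans q tops).1
  push q tops := (P.trans q tops).2

end SolverData

/-- The contents of the stacks of the solving machine. -/
structure Store (A E : Type) (J : ℕ) where
  inp : List (Option Color)
  out : List OutSym
  left : List A
  right : List A
  half : ℕ
  count : E → ℕ
  tokens : E → Fin (J + 1) → List (Option (Bool × Turn))
  ticks : Bool → ℕ
  temp : ℕ

def Store.stacks {A E : Type} {J : ℕ} (S : Store A E J) : ∀ k, List (Alphabet A E J k)
  | .inp => S.inp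
  | .out => S.out
  | .left => S.left
  | .right => S.right
  | .half => List.replicate S.half ()
  | .count e => List.replicate (S.count e) ()
  | .tokens e j => S.tokens e j
  | .ticks u => List.replicate (S.ticks u) ()
  | .temp => List.replicate S.temp ()

namespace SolverData
variable {A E : Type} (P : SolverData A E)

theorem keep_append_tail (S : Store A E P.maxLong) (k : Stack E P.maxLong) :
    P.keep (fun k => (S.stacks k).head?) k ++ (S.stacks k).tail = S.stacks k := by
  rw [keep]
  cases S.stacks k <;> rfl

theorem keepWith_append_tail (S : Store A E P.maxLong) (k : Stack E P.maxLong)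
    (l : List (Alphabet A E P.maxLong k)) :
    P.keepWith (fun k => (S.stacks k).head?) k l ++ (S.stacks k).tail = l ++ S.stacks k := by
  rw [keepWith, List.append_assoc]
  exact congrArg (l ++ ·) (P.keep_append_tail S k)

variable [DecidableEq E]

/-- One step of the machine, in terms of stores. -/
def Step (q : State P.blockLength E P.maxLong) (S : Store A E P.maxLong)
    (q' : State P.blockLength E P.maxLong) (S' : Store A E P.maxLong) : Prop :=
  P.machine.stepTo (q, S.stacks) = (q', S'.stacks)

/-- Runs of the machine, in terms of stores. -/
def Run (T : ℕ) (q : State P.blockLength E P.maxLong) (S : Store A E P.maxLong)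
    (q' : State P.blockLength E P.maxLong) (S' : Store A E P.maxLong) : Prop :=
  P.machine.Runs T (q, S.stacks) (q', S'.stacks)

variable {P}

theorem step_of {q q' : State P.blockLength E P.maxLong} {S S' : Store A E P.maxLong}
    (h1 : (P.trans q fun k => (S.stacks k).head?).1 = q')
    (h2 : ∀ k, (P.trans q fun k => (S.stacks k).head?).2 k ++ (S.stacks k).tail = S'.stacks k) :
    P.Step q S q' S' :=
  Prod.ext h1 (funext h2)

theorem Step.run {T : ℕ} {q q' q'' : State P.blockLength E P.maxLong}
    {S S' S'' : Store A E P.maxLong} (h : P.Step q S q' S')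
    (h' : P.Run T q' S' q'' S'') (hq : q ≠ .done := by simp) : P.Run (T + 1) q S q'' S'' := by
  refine .step ?_ (h.symm ▸ h')
  cases q <;> first | rfl | exact (hq rfl).elim

end SolverData

/-! ### Single steps of the solving machine -/

namespace SolverData
variable {A E : Type} [DecidableEq E] {P : SolverData A E} (S : Store A E P.maxLong)

theorem step_read_nil (buf : {l : List (Option Color) // l.length ≤ P.blockLength}) (odd : Bool)
    (h : S.inp = []) : P.Step (.read buf odd) S (.split odd) S := by
  have h' : (S.stacks .inp).head? = none := congrArg List.head? h
  apply step_of
  · simp only [trans, h']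
  · intro k
    simp only [trans, h']
    exact P.keep_append_tail S k

theorem step_read_cons {buf : List (Option Color)} (odd : Bool) {c : Option Color}
    {l : List (Option Color)} (h : S.inp = c :: l) (hb : buf.length + 1 < P.blockLength) :
    P.Step (.read ⟨buf, by omega⟩ odd) S
      (.read ⟨buf ++ [c], by simpa using hb.le⟩ odd) { S with inp := l } := by
  have h' : (S.stacks .inp).head? = some c := congrArg List.head? h
  apply step_of
  · simp only [trans, h', hb, dif_pos]
  · intro k
    simp only [trans, h', hb, dif_pos]
    cases k <;> first | exact P.keep_append_tail S _ | skip
    exact congrArg List.tail h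

theorem step_read_last {buf : {l : List (Option Color) // l.length ≤ P.blockLength}} (odd : Bool)
    {c : Option Color} {l : List (Option Color)} (h : S.inp = c :: l)
    (hb : ¬ buf.1.length + 1 < P.blockLength) :
    P.Step (.read buf odd) S (.read ⟨[], Nat.zero_le _⟩ !odd)
      { S with
        inp := l
        left := P.decode (buf.1 ++ [c]) :: S.left
        half := if odd then S.half + 1 else S.half
        ticks := update S.ticks true (S.ticks true + 1) } := by
  have h' : (S.stacks .inp).head? = some c := congrArg List.head? h
  apply step_of
  · simp only [trans, h', hb, dif_neg, not_false_eq_true]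
  · intro k
    simp only [trans, h', hb, dif_neg, not_false_eq_true]
    cases k with
    | inp => exact congrArg List.tail h
    | left => exact congrArg (List.cons _) (P.keep_append_tail S .left)
    | half =>
      cases odd
      · exact P.keep_append_tail S .half
      · exact congrArg (List.cons _) (P.keep_append_tail S .half)
    | ticks u =>
      cases u
      · exact P.keep_append_tail S (.ticks false)
      · exact congrArg (List.cons _) (P.keep_append_tail S (.ticks true))
    | _ => exact P.keep_append_tail S _

theorem tail_replicate {m k : ℕ} (h : m = k + 1) :
    (List.replicate m ()).tail = List.replicate k () := by
  rw [h]
  rfl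

theorem head_replicate {m k : ℕ} (h : m = k + 1) :
    (List.replicate m ()).head? = some () := by
  rw [h]
  rfl

theorem head_replicate_zero {m : ℕ} (h : m = 0) : (List.replicate m ()).head? = none := by
  rw [h]
  rfl

theorem step_split_succ (odd : Bool) {m : ℕ} {a : A} {l : List A} (h : S.half = m + 1)
    (hl : S.left = a :: l) : P.Step (.split odd) S (.split odd)
      { S with half := m, left := l, right := a :: S.right } := by
  have h1 : (S.stacks .half).head? = some () := head_replicate h
  have h2 : (S.stacks .left).head? = some a := congrArg List.head? hl
  apply step_of
  · simp only [trans, h1, h2]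
  · intro k
    simp only [trans, h1, h2]
    cases k with
    | left => exact congrArg List.tail hl
    | right => exact congrArg (List.cons _) (P.keep_append_tail S .right)
    | half => exact tail_replicate h
    | _ => exact P.keep_append_tail S _

theorem step_split_zero (odd : Bool) (h : S.half = 0) :
    P.Step (.split odd) S (if odd then .middle else .pair fun _ => true) S := by
  have h1 : (S.stacks .half).head? = none := head_replicate_zero h
  apply step_of
  · simp only [trans, h1]
  · intro k
    simp only [trans, h1]
    exact P.keep_append_tail S k

/-- Record a cluster for all candidates. -/
def absorb (P : SolverData A E) (x : Kind × A × A) (S : Store A E P.maxLong) :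
    Store A E P.maxLong :=
  { S with
    count := fun e => P.cost e x + S.count e
    tokens := fun e j => (P.moves e j x).reverse.map some ++ none :: S.tokens e j }

omit [DecidableEq E] in
theorem keepWith_count (m : ℕ) (e : E) :
    P.keepWith (fun k => (S.stacks k).head?) (.count e) (List.replicate m ()) ++
      (S.stacks (.count e)).tail = List.replicate (m + S.count e) () :=
  (P.keepWith_append_tail S (.count e) _).trans List.replicate_append_replicate

omit [DecidableEq E] in
theorem keepWith_tokens (l : List (Option (Bool × Turn))) (e : E) (j : Fin (P.maxLong + 1)) :
    P.keepWith (fun k => (S.stacks k).head?) (.tokens e j) (l ++ [none]) ++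
      (S.stacks (.tokens e j)).tail = l ++ none :: S.tokens e j :=
  (P.keepWith_append_tail S (.tokens e j) _).trans (List.append_assoc _ _ _)

theorem step_middle {a : A} {l : List A} (hl : S.left = a :: l) :
    P.Step .middle S
      (.pair fun e => P.feasible e
        (if S.right.head?.isNone then Kind.single else Kind.middle, a, a))
      (P.absorb (if S.right.head?.isNone then Kind.single else Kind.middle, a, a)
        { S with left := l }) := by
  have h2 : (S.stacks .left).head? = some a := congrArg List.head? hl
  apply step_of
  · simp only [trans, h2]
    rfl
  · intro k
    simp only [trans, h2]
    cases k with
    | left => exact congrArg List.tail hl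
    | count e => exact keepWith_count S _ e
    | tokens e j => exact keepWith_tokens S _ e j
    | _ => exact P.keep_append_tail S _

theorem step_pair_cons (f : E → Bool) {a b : A} {l r : List A} (hl : S.left = a :: l)
    (hr : S.right = b :: r) :
    P.Step (.pair f) S (.pair fun e => f e && P.feasible e (Kind.pair, a, b))
      (P.absorb (Kind.pair, a, b) { S with left := l, right := r }) := by
  have h1 : (S.stacks .left).head? = some a := congrArg List.head? hl
  have h2 : (S.stacks .right).head? = some b := congrArg List.head? hr
  apply step_of
  · simp only [trans, h1, h2]
  · intro k
    simp only [trans, h1, h2]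
    cases k with
    | left => exact congrArg List.tail hl
    | right => exact congrArg List.tail hr
    | count e => exact keepWith_count S _ e
    | tokens e j => exact keepWith_tokens S _ e j
    | _ => exact P.keep_append_tail S _

theorem step_pair_nil (f : E → Bool) (hl : S.left = []) :
    P.Step (.pair f) S (.compare f)
      { S with count := fun e => P.numLong e + S.count e } := by
  have h1 : (S.stacks .left).head? = none := congrArg List.head? hl
  apply step_of
  · simp only [trans, h1]
  · intro k
    simp only [trans, h1]
    cases k with
    | count e => exact keepWith_count S _ e
    | _ => exact P.keep_append_tail S _

omit [DecidableEq E] in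
theorem isNone_count_iff (e : E) : ((S.stacks (.count e)).head?).isNone ↔ S.count e = 0 := by
  change ((List.replicate (S.count e) ()).head?).isNone ↔ _
  cases S.count e <;> simp [List.replicate_succ]

/-- Which of several candidates is taken is left to choice, hence the existential. -/
theorem step_compare_found {f : E → Bool} (h : ∃ e, f e = true ∧ S.count e = 0) :
    ∃ e, f e = true ∧ S.count e = 0 ∧
      P.Step (.compare f) S (.tokens e (P.numLong e)) S := by
  have h' : ∃ e, f e = true ∧ ((S.stacks (.count e)).head?).isNone := by
    simpa only [isNone_count_iff] using h
  have hs := h'.choose_spec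
  refine ⟨h'.choose, hs.1, (isNone_count_iff S _).1 hs.2, ?_⟩
  apply step_of
  · rw [trans, dif_pos h']
  · intro k
    rw [trans, dif_pos h']
    exact P.keep_append_tail S k

/-- Counters of infeasible candidates may be empty already; truncated subtraction agrees with
popping an empty stack. -/
theorem step_compare_step {f : E → Bool} (h : ∀ e, f e = true → S.count e ≠ 0)
    (hf : ∃ e, f e = true) :
    P.Step (.compare f) S (.compare f) { S with count := fun e => S.count e - 1 } := by
  have h' : ¬ ∃ e, f e = true ∧ ((S.stacks (.count e)).head?).isNone := by
    simp only [isNone_count_iff, not_exists, not_and]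
    exact h
  apply step_of
  · rw [trans, dif_neg h', if_pos hf]
  · intro k
    rw [trans, dif_neg h', if_pos hf]
    cases k with
    | count e => exact List.tail_replicate
    | _ => exact P.keep_append_tail S _

theorem step_compare_none {f : E → Bool} (h : ∀ e, f e = false) :
    P.Step (.compare f) S .clean { S with out := OutSym.unsolvable :: S.out } := by
  have h' : ¬ ∃ e, f e = true ∧ ((S.stacks (.count e)).head?).isNone := by simp [h]
  have h'' : ¬ ∃ e, f e = true := by simp [h]
  apply step_of
  · rw [trans, dif_neg h', if_neg h'']
  · intro k
    rw [trans, dif_neg h', if_neg h'']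
    cases k with
    | out => exact congrArg (List.cons _) (P.keep_append_tail S .out)
    | _ => exact P.keep_append_tail S _

theorem step_tokens_nil {e : E} {j : Fin (P.maxLong + 1)} (h : S.tokens e j = []) :
    P.Step (.tokens e j) S (.reset e j) S := by
  have h1 : (S.stacks (.tokens e j)).head? = none := congrArg List.head? h
  apply step_of
  · simp only [trans, h1]
  · intro k
    simp only [trans, h1]
    exact P.keep_append_tail S k

/-- Replace the contents of one of the token stacks. -/
def setTokens (e : E) (j : Fin (P.maxLong + 1)) (l : List (Option (Bool × Turn))) :
    E → Fin (P.maxLong + 1) → List (Option (Bool × Turn)) :=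
  update S.tokens e (update (S.tokens e) j l)

theorem setTokens_apply {e : E} {j : Fin (P.maxLong + 1)} {o : Option (Bool × Turn)}
    {l : List (Option (Bool × Turn))} (h : S.tokens e j = o :: l) (e' : E)
    (j' : Fin (P.maxLong + 1)) :
    (if e' = e ∧ j' = j then [] else P.keep (fun k => (S.stacks k).head?) (.tokens e' j')) ++
      (S.stacks (.tokens e' j')).tail = setTokens S e j l e' j' := by
  by_cases h' : e' = e ∧ j' = j
  · obtain ⟨rfl, rfl⟩ := h'
    rw [if_pos ⟨rfl, rfl⟩, setTokens, update_self, update_self]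
    exact congrArg List.tail h
  · rw [if_neg h', P.keep_append_tail S]
    by_cases he : e' = e
    · subst he
      have hj : j' ≠ j := fun hj => h' ⟨rfl, hj⟩
      rw [setTokens, update_self, update_of_ne hj]
      rfl
    · rw [setTokens, update_of_ne he]
      rfl

theorem step_tokens_none {e : E} {j : Fin (P.maxLong + 1)} {l : List (Option (Bool × Turn))}
    (h : S.tokens e j = none :: l) {i : ℕ} (hi : S.ticks true = i + 1) :
    P.Step (.tokens e j) S (.tokens e j) { S with
      tokens := setTokens S e j l
      ticks := fun u => if u then i else S.ticks false + 1 } := by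
  have h1 : (S.stacks (.tokens e j)).head? = some none := congrArg List.head? h
  apply step_of
  · simp only [trans, h1]
  · intro k
    simp only [trans, h1]
    cases k with
    | tokens e' j' => exact setTokens_apply S h e' j'
    | ticks u =>
      cases u
      · exact congrArg (List.cons _) (P.keep_append_tail S (.ticks false))
      · exact tail_replicate hi
    | _ => exact P.keep_append_tail S _

theorem step_tokens_false {e : E} {j : Fin (P.maxLong + 1)} {l : List (Option (Bool × Turn))}
    {t : Turn} (h : S.tokens e j = some (false, t) :: l) :
    P.Step (.tokens e j) S (.emit e j false) { S with
      tokens := setTokens S e j l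
      out := OutSym.turn t :: S.out } := by
  have h1 : (S.stacks (.tokens e j)).head? = some (some (false, t)) := congrArg List.head? h
  apply step_of
  · simp only [trans, h1]
  · intro k
    simp only [trans, h1]
    cases k with
    | tokens e' j' => exact setTokens_apply S h e' j'
    | out => exact congrArg (List.cons _) (P.keep_append_tail S .out)
    | ticks u => cases u <;> exact P.keep_append_tail S _
    | _ => exact P.keep_append_tail S _

theorem step_tokens_true {e : E} {j : Fin (P.maxLong + 1)} {l : List (Option (Bool × Turn))}
    {t : Turn} (h : S.tokens e j = some (true, t) :: l) {i : ℕ} (hi : S.ticks true = i + 1) :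
    P.Step (.tokens e j) S (.emit e j true) { S with
      tokens := setTokens S e j l
      out := OutSym.turn t :: S.out
      ticks := update S.ticks true i
      temp := S.temp + 1 } := by
  have h1 : (S.stacks (.tokens e j)).head? = some (some (true, t)) := congrArg List.head? h
  apply step_of
  · simp only [trans, h1]
  · intro k
    simp only [trans, h1]
    cases k with
    | tokens e' j' => exact setTokens_apply S h e' j'
    | out => exact congrArg (List.cons _) (P.keep_append_tail S .out)
    | temp => exact congrArg (List.cons _) (P.keep_append_tail S .temp)
    | ticks u =>
      cases u
      · exact P.keep_append_tail S (.ticks false)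
      · exact tail_replicate hi
    | _ => exact P.keep_append_tail S _

theorem step_emit_succ {e : E} {j : Fin (P.maxLong + 1)} {u : Bool} {i : ℕ}
    (hi : S.ticks u = i + 1) :
    P.Step (.emit e j u) S (.emit e j u) { S with
      ticks := update S.ticks u i
      temp := S.temp + 1
      out := OutSym.tick :: S.out } := by
  have h1 : (S.stacks (.ticks u)).head? = some () := head_replicate hi
  apply step_of
  · simp only [trans, h1]
  · intro k
    simp only [trans, h1]
    cases k with
    | out => exact congrArg (List.cons _) (P.keep_append_tail S .out)
    | temp => exact congrArg (List.cons _) (P.keep_append_tail S .temp)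
    | ticks u' =>
      by_cases hu : u' = u
      · subst hu
        simp only [if_true, Store.stacks, update_self]
        exact tail_replicate hi
      · simp only [if_neg hu]
        rw [P.keep_append_tail S]
        simp only [Store.stacks, update_of_ne hu]
    | _ => exact P.keep_append_tail S _

theorem step_emit_zero {e : E} {j : Fin (P.maxLong + 1)} {u : Bool} (hi : S.ticks u = 0) :
    P.Step (.emit e j u) S (.restore e j u) { S with out := OutSym.axis 2 :: S.out } := by
  have h1 : (S.stacks (.ticks u)).head? = none := head_replicate_zero hi
  apply step_of
  · simp only [trans, h1]
  · intro k
    simp only [trans, h1]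
    cases k with
    | out => exact congrArg (List.cons _) (P.keep_append_tail S .out)
    | _ => exact P.keep_append_tail S _

theorem step_restore_succ {e : E} {j : Fin (P.maxLong + 1)} {u : Bool} {i : ℕ}
    (hi : S.temp = i + 1) :
    P.Step (.restore e j u) S (.restore e j u) { S with
      ticks := update S.ticks u (S.ticks u + 1)
      temp := i } := by
  have h1 : (S.stacks .temp).head? = some () := head_replicate hi
  apply step_of
  · simp only [trans, h1]
  · intro k
    simp only [trans, h1]
    cases k with
    | temp => exact tail_replicate hi
    | ticks u' =>
      by_cases hu : u' = u
      · subst hu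
        simp only [if_true, Store.stacks, update_self]
        exact congrArg (List.cons _) (P.keep_append_tail S (.ticks u'))
      · simp only [if_neg hu]
        rw [P.keep_append_tail S]
        simp only [Store.stacks, update_of_ne hu]
    | _ => exact P.keep_append_tail S _

theorem step_restore_zero {e : E} {j : Fin (P.maxLong + 1)} {u : Bool} (hi : S.temp = 0) :
    P.Step (.restore e j u) S (.tokens e j) S := by
  have h1 : (S.stacks .temp).head? = none := head_replicate_zero hi
  apply step_of
  · simp only [trans, h1]
  · intro k
    simp only [trans, h1]
    exact P.keep_append_tail S k

theorem step_reset_succ {e : E} {j : Fin (P.maxLong + 1)} {i : ℕ}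
    (hi : S.ticks false = i + 1) :
    P.Step (.reset e j) S (.reset e j) { S with
      ticks := fun u => if u then S.ticks true + 1 else i } := by
  have h1 : (S.stacks (.ticks false)).head? = some () := head_replicate hi
  apply step_of
  · simp only [trans, h1]
  · intro k
    simp only [trans, h1]
    cases k with
    | ticks u =>
      cases u
      · exact tail_replicate hi
      · exact congrArg (List.cons _) (P.keep_append_tail S (.ticks true))
    | _ => exact P.keep_append_tail S _

theorem step_reset_last {e : E} {j : Fin (P.maxLong + 1)} (hi : S.ticks false = 0)
    (hj : (j : ℕ) = 0) : P.Step (.reset e j) S .clean S := by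
  have h1 : (S.stacks (.ticks false)).head? = none := head_replicate_zero hi
  apply step_of
  · simp only [trans, h1, hj, if_true]
  · intro k
    simp only [trans, h1, hj, if_true]
    exact P.keep_append_tail S k

theorem step_reset_zero {e : E} {j : ℕ} (hj : j + 1 < P.maxLong + 1) (hi : S.ticks false = 0) :
    P.Step (.reset e ⟨j + 1, hj⟩) S (.tokens e ⟨j, by omega⟩)
      { S with out := P.longCode e j ++ S.out } := by
  have h1 : (S.stacks (.ticks false)).head? = none := head_replicate_zero hi
  apply step_of
  · simp only [trans, h1, Nat.succ_ne_zero, if_false]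
    rfl
  · intro k
    simp only [trans, h1, Nat.succ_ne_zero, if_false]
    cases k with
    | out =>
      exact P.keepWith_append_tail S .out _
    | _ => exact P.keep_append_tail S _

/-- The stacks at the end of the computation. -/
def outOnly (P : SolverData A E) (l : List OutSym) : ∀ k, List (Alphabet A E P.maxLong k)
  | .out => l
  | _ => []

omit [DecidableEq E] in
theorem outOnly_of_ne (l : List OutSym) {k : Stack E P.maxLong} (hk : k ≠ .out) :
    P.outOnly l k = [] := by
  cases k <;> first | rfl | exact (hk rfl).elim

open Classical in
theorem stepTo_clean_snd (stk : ∀ k, List (Alphabet A E P.maxLong k)) (k : Stack E P.maxLong) :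
    (P.machine.stepTo (.clean, stk)).2 k = if k = .out then stk k else (stk k).tail := by
  by_cases hk : k = .out
  · subst hk
    rw [if_pos rfl]
    change P.keep (fun k => (stk k).head?) .out ++ (stk .out).tail = stk .out
    rw [keep]
    cases stk .out <;> rfl
  · rw [if_neg hk]
    cases k <;> first | exact (hk rfl).elim | rfl

open Classical in
theorem stepTo_clean_fst (stk : ∀ k, List (Alphabet A E P.maxLong k)) :
    (P.machine.stepTo (.clean, stk)).1 =
      if ∀ k, k ≠ .out → (stk k).head? = none then .done else .clean :=
  rfl

/-- Every step shortens all non-empty stacks except the output at once, so the highest of them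
bounds the time. -/
theorem runs_clean (m : ℕ) (stk : ∀ k, List (Alphabet A E P.maxLong k))
    (h : ∀ k, k ≠ .out → (stk k).length ≤ m) :
    P.machine.Runs (m + 1) (.clean, stk) (.done, P.outOnly (stk .out)) := by
  induction m generalizing stk with
  | zero =>
    have e : P.machine.stepTo (.clean, stk) = (.done, P.outOnly (stk .out)) := by
      have h0 : ∀ k, k ≠ .out → stk k = [] := fun k hk =>
        List.length_eq_zero_iff.1 (Nat.le_zero.1 (h k hk))
      apply Prod.ext
      · rw [stepTo_clean_fst, if_pos fun k hk => by rw [h0 k hk]; rfl]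
      · funext k
        rw [stepTo_clean_snd]
        by_cases hk : k = .out
        · subst hk
          exact if_pos rfl
        · exact (if_neg hk).trans
            ((congrArg List.tail (h0 k hk)).trans (outOnly_of_ne _ hk).symm)
    exact .step rfl (e ▸ .refl _ _)
  | succ m ih =>
    refine .step rfl ?_
    by_cases hq : ∀ k, k ≠ .out → (stk k).head? = none
    · have e : P.machine.stepTo (.clean, stk) = (.done, P.outOnly (stk .out)) := by
        apply Prod.ext
        · rw [stepTo_clean_fst, if_pos hq]
        · funext k
          rw [stepTo_clean_snd]
          by_cases hk : k = .out
          · subst hk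
            exact if_pos rfl
          · exact (if_neg hk).trans ((congrArg List.tail
              (List.head?_eq_none_iff.1 (hq k hk))).trans (outOnly_of_ne _ hk).symm)
      rw [e]
      exact .refl _ _
    · have := ih (P.machine.stepTo (.clean, stk)).2 fun k hk => by
        rw [stepTo_clean_snd, if_neg hk, List.length_tail]
        have := h k hk
        omega
      rw [stepTo_clean_snd, if_pos rfl] at this
      have e : (P.machine.stepTo (.clean, stk)).1 = .clean := by
        rw [stepTo_clean_fst, if_neg hq]
      have e' : P.machine.stepTo (.clean, stk) =
          (.clean, (P.machine.stepTo (.clean, stk)).2) := Prod.ext e rfl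
      exact (congrArg (fun c => P.machine.Runs (m + 1) c _) e').mpr this

end SolverData
end RubikCube

/-! ### The phases of the computation -/

namespace RubikCube
open Function

/-- The contents of the two tick stacks. -/
def tickPair (a b : ℕ) : Bool → ℕ := fun u => if u then b else a

@[simp] theorem tickPair_true (a b : ℕ) : tickPair a b true = b := rfl
@[simp] theorem update_tickPair_false (a b c : ℕ) :
    update (tickPair a b) false c = tickPair c b := by
  funext u
  cases u <;> rfl
@[simp] theorem update_tickPair_true (a b c : ℕ) :
    update (tickPair a b) true c = tickPair a c := by
  funext u
  cases u <;> rfl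

/-- The cluster `i` of a cube with the given slices. -/
def slicePair {A : Type} (n : ℕ) (s : ℕ → A) (i : ℕ) : Kind × A × A :=
  (clusterKind n i, s i, s (n - 1 - i))

/-- The code of a move of cluster `i`. -/
def moveCode (n i : ℕ) (m : Bool × Turn) : List OutSym :=
  OutSym.axis 2 :: (List.replicate (if m.1 then n - 1 - i else i) OutSym.tick ++ [OutSym.turn m.2])

/-- The lists `f 0`, `g 0`, `f 1`, `g 1` and so on, up to `f j`, one after the other. -/
def alternate {α : Type} (f g : ℕ → List α) : ℕ → List α
  | 0 => f 0
  | j + 1 => alternate f g j ++ (g j ++ f (j + 1))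

/-- `alternate` grows at its end, which suits backward printing, while `famInterleave` recurses from
the front; this passes from one to the other. -/
theorem alternate_succ {α : Type} (f g : ℕ → List α) (j : ℕ) :
    alternate f g (j + 1) =
      f 0 ++ (g 0 ++ alternate (fun j => f (j + 1)) (fun j => g (j + 1)) j) := by
  induction j with
  | zero => rfl
  | succ j ih =>
    rw [alternate, ih, alternate]
    simp

namespace SolverData
variable {A E : Type} [DecidableEq E] {P : SolverData A E}

theorem Run.refl (T : ℕ) (q : State P.blockLength E P.maxLong) (S : Store A E P.maxLong) :
    P.Run T q S q S := StackMachine.Runs.refl _ _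

theorem Run.mono {T T' : ℕ} {q q' : State P.blockLength E P.maxLong}
    {S S' : Store A E P.maxLong} (h : P.Run T q S q' S') (hT : T ≤ T') : P.Run T' q S q' S' :=
  StackMachine.Runs.mono h hT

theorem Run.trans {T T' : ℕ} {q q' q'' : State P.blockLength E P.maxLong}
    {S S' S'' : Store A E P.maxLong} (h : P.Run T q S q' S') (h' : P.Run T' q' S' q'' S'') :
    P.Run (T + T') q S q'' S'' :=
  StackMachine.Runs.trans h h'

theorem Run.cast {T : ℕ} {q q' : State P.blockLength E P.maxLong} {S S' S'' : Store A E P.maxLong}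
    (h : P.Run T q S q' S') (e : S' = S'') : P.Run T q S q' S'' := e ▸ h

section Read

theorem run_readBlock (S : Store A E P.maxLong) (odd : Bool) (buf l rest : List (Option Color))
    (hl : l ≠ []) (hlen : buf.length + l.length = P.blockLength) (h : S.inp = l ++ rest) :
    P.Run l.length (.read ⟨buf, by omega⟩ odd) S (.read ⟨[], Nat.zero_le _⟩ !odd)
      { S with
        inp := rest
        left := P.decode (buf ++ l) :: S.left
        half := if odd then S.half + 1 else S.half
        ticks := update S.ticks true (S.ticks true + 1) } := by
  induction l generalizing S buf with
  | nil => exact (hl rfl).elim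
  | cons c l ih =>
    rw [List.length_cons] at hlen ⊢
    by_cases hl' : l = []
    · subst hl'
      exact (step_read_last S (buf := ⟨buf, by omega⟩) odd h (by simp at hlen ⊢; omega)).run
        (.refl _ _ _)
    · have hpos := List.length_pos_iff.2 hl'
      refine (step_read_cons S odd h (by omega)).run
        ((ih { S with inp := l ++ rest } (buf ++ [c]) hl' (by simp; omega) rfl).cast ?_)
      simp

theorem run_read (hb : 0 < P.blockLength) (enc : A → List (Option Color))
    (hlen : ∀ a, (enc a).length = P.blockLength) (hdec : ∀ a, P.decode (enc a) = a) (as l : List A)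
    (k : ℕ) :
    P.Run (as.length * P.blockLength + 1) (.read ⟨[], Nat.zero_le _⟩ (decide (k % 2 = 1)))
      ⟨as.flatMap enc, [], l, [], k / 2, fun _ => 0, fun _ _ => [], tickPair 0 k, 0⟩
      (.split (decide ((k + as.length) % 2 = 1)))
      ⟨[], [], as.reverse ++ l, [], (k + as.length) / 2, fun _ => 0, fun _ _ => [],
        tickPair 0 (k + as.length), 0⟩ := by
  induction as generalizing l k with
  | nil => exact (step_read_nil _ _ _ rfl).run (.refl _ _ _)
  | cons a as ih =>
    have h1 := run_readBlock (P := P)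
      ⟨(a :: as).flatMap enc, [], l, [], k / 2, fun _ => 0, fun _ _ => [], tickPair 0 k, 0⟩
      (decide (k % 2 = 1)) [] (enc a) (as.flatMap enc)
      (List.length_pos_iff.1 ((hlen a).symm ▸ hb)) (by simp [hlen a]) rfl
    have h2 := ih (a :: l) (k + 1)
    have e1 : (!decide (k % 2 = 1)) = decide ((k + 1) % 2 = 1) := by
      rw [← decide_not]
      congr 1
      exact propext ⟨fun h => by omega, fun h => by omega⟩
    have e2 : (if decide (k % 2 = 1) = true then k / 2 + 1 else k / 2) = (k + 1) / 2 := by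
      split <;> simp_all <;> omega
    have e3 : k + (a :: as).length = k + 1 + as.length := by rw [List.length_cons]; omega
    simp only [List.nil_append, hdec, update_tickPair_true, tickPair_true, e1, e2] at h1
    rw [e3, List.reverse_cons, List.append_assoc]
    refine (h1.trans h2).mono ?_
    rw [hlen, List.length_cons, Nat.add_mul]
    omega

end Read

section Collect

theorem run_split (odd : Bool) (l₁ l₂ r : List A) (n : ℕ) :
    P.Run (l₁.length + 1) (.split odd)
      ⟨[], [], l₁ ++ l₂, r, l₁.length, fun _ => 0, fun _ _ => [], tickPair 0 n, 0⟩
      (if odd then .middle else .pair fun _ => true)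
      ⟨[], [], l₂, l₁.reverse ++ r, 0, fun _ => 0, fun _ _ => [], tickPair 0 n, 0⟩ := by
  induction l₁ generalizing r with
  | nil => exact (step_split_zero _ odd rfl).run (.refl _ _ _)
  | cons a l₁ ih =>
    refine (step_split_succ _ odd (m := l₁.length) rfl (List.cons_append ..)).run
      ((ih (a :: r)).cast ?_)
    simp

/-- What a cluster contributes to a token stack. -/
def tokenBlock (P : SolverData A E) (e : E) (j : ℕ) (x : Kind × A × A) :
    List (Option (Bool × Turn)) :=
  (P.moves e j x).reverse.map some ++ [none]

/-- The store after the clusters `xs` have been recorded. -/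
def loaded (P : SolverData A E) (n : ℕ) (xs : List (Kind × A × A)) (l r : List A) :
    Store A E P.maxLong :=
  ⟨[], [], l, r, 0, fun e => (xs.map (P.cost e)).sum,
    fun e j => xs.reverse.flatMap (P.tokenBlock e j), tickPair 0 n, 0⟩

omit [DecidableEq E] in
theorem absorb_loaded (n : ℕ) (xs : List (Kind × A × A)) (x : Kind × A × A) (l r : List A) :
    P.absorb x (P.loaded n xs l r) = P.loaded n (xs ++ [x]) l r := by
  simp [absorb, loaded, tokenBlock, Nat.add_comm]

theorem run_pair {I : Type} (n : ℕ) (is : List I) (s s' : I → A) (xs : List (Kind × A × A)) :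
    P.Run (is.length + 1) (.pair fun e => xs.all (P.feasible e))
      (P.loaded n xs (is.map s) (is.map s'))
      (.compare fun e => (xs ++ is.map fun i => (Kind.pair, s i, s' i)).all (P.feasible e))
      { P.loaded n (xs ++ is.map fun i => (Kind.pair, s i, s' i)) [] [] with
        count := fun e => P.numLong e +
          ((xs ++ is.map fun i => (Kind.pair, s i, s' i)).map (P.cost e)).sum } := by
  induction is generalizing xs with
  | nil =>
    rw [List.map_nil, List.map_nil, List.map_nil, List.append_nil]
    exact (step_pair_nil _ _ rfl).run (.refl _ _ _)
  | cons i is ih =>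
    have h := ih (xs ++ [(Kind.pair, s i, s' i)])
    rw [List.append_assoc, List.singleton_append] at h
    have e : (fun e => xs.all (P.feasible e) && P.feasible e (Kind.pair, s i, s' i)) =
        fun e => (xs ++ [(Kind.pair, s i, s' i)]).all (P.feasible e) := by
      funext e
      simp
    have h1 := step_pair_cons (P := P) (P.loaded n xs ((i :: is).map s) ((i :: is).map s'))
      (fun e => xs.all (P.feasible e)) (List.map_cons ..) (List.map_cons ..)
    rw [e, show { P.loaded n xs ((i :: is).map s) ((i :: is).map s') with
      left := is.map s, right := is.map s' } = P.loaded n xs (is.map s) (is.map s') from rfl,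
      absorb_loaded] at h1
    exact h1.run h

/-- Cuts the stack of slices into the upper `h` ones, listed by the indices of their mirror slices,
and the rest. -/
theorem reverse_range_add (h k : ℕ) : (List.range (h + k)).reverse =
    (List.range h).map (fun i => h + k - 1 - i) ++ (List.range k).reverse := by
  induction h generalizing k with
  | zero => simp
  | succ h ih =>
    rw [show h + 1 + k = h + (k + 1) by omega, ih, List.range_succ, List.range_succ]
    simp only [List.reverse_append, List.reverse_singleton, List.singleton_append, List.map_append,
      List.map_singleton, List.append_assoc]
    rw [show h + (k + 1) - 1 - h = k by omega]

theorem clusterKind_pair {n i : ℕ} (h : i < n / 2) : clusterKind n i = Kind.pair := by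
  rw [clusterKind, if_neg (by omega)]

theorem run_collect (n : ℕ) (s : ℕ → A) :
    P.Run (2 * n + 4) (.split (decide (n % 2 = 1)))
      ⟨[], [], ((List.range n).map s).reverse, [], n / 2, fun _ => 0, fun _ _ => [],
        tickPair 0 n, 0⟩
      (.compare fun e => ((List.range ((n + 1) / 2)).reverse.map (slicePair n s)).all
        (P.feasible e))
      { P.loaded n ((List.range ((n + 1) / 2)).reverse.map (slicePair n s)) [] [] with
        count := fun e => P.numLong e +
          (((List.range ((n + 1) / 2)).reverse.map (slicePair n s)).map (P.cost e)).sum } := by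
  obtain ⟨k, hk⟩ : ∃ k, n = n / 2 + k := ⟨n - n / 2, by omega⟩
  have e0 : ((List.range n).map s).reverse =
      (List.range (n / 2)).map (fun i => s (n - 1 - i)) ++ (List.range k).reverse.map s := by
    rw [← List.map_reverse]
    conv_lhs => rw [hk]
    rw [reverse_range_add, ← hk, List.map_append, List.map_map]
    rfl
  have h1 := run_split (P := P) (decide (n % 2 = 1))
    ((List.range (n / 2)).map (fun i => s (n - 1 - i))) ((List.range k).reverse.map s) [] n
  rw [List.length_map, List.length_range, List.append_nil, ← List.map_reverse, ← e0] at h1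
  have e1 : ∀ is : List ℕ, (∀ i ∈ is, i < n / 2) →
      is.map (fun i => (Kind.pair, s i, s (n - 1 - i))) = is.map (slicePair n s) := by
    intro is his
    refine List.map_congr_left fun i hi => ?_
    rw [slicePair, clusterKind_pair (his i hi)]
  have e2 : ∀ i ∈ (List.range (n / 2)).reverse, i < n / 2 := fun i hi => by simpa using hi
  -- For odd n one slice more remains on `left` than is moved to `right`, namely the middle one.
  by_cases hn : n % 2 = 1
  · have hk' : k = n / 2 + 1 := by omega
    have hN : (n + 1) / 2 = n / 2 + 1 := by omega
    subst hk'
    simp only [hn, decide_true, if_true] at h1 ⊢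
    have e3 : (List.range (n / 2 + 1)).reverse = n / 2 :: (List.range (n / 2)).reverse := by
      rw [List.range_succ, List.reverse_append]
      rfl
    rw [hN, e3, List.map_cons]
    rw [e3, List.map_cons] at h1
    have h2 := step_middle (P := P) (P.loaded n [] (s (n / 2) :: (List.range (n / 2)).reverse.map s)
      ((List.range (n / 2)).reverse.map fun i => s (n - 1 - i))) rfl
    have e4 : ((if (P.loaded n [] (s (n / 2) :: (List.range (n / 2)).reverse.map s)
        ((List.range (n / 2)).reverse.map fun i => s (n - 1 - i))).right.head?.isNone
        then Kind.single else Kind.middle, s (n / 2), s (n / 2)) : Kind × A × A) =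
        slicePair n s (n / 2) := by
      have e5 : n - 1 - n / 2 = n / 2 := by omega
      have e6 : clusterKind n (n / 2) = if n = 1 then Kind.single else Kind.middle :=
        if_pos (by omega)
      rw [slicePair, e5, e6]
      congr 1
      by_cases h1 : n = 1
      · subst h1
        rfl
      · obtain ⟨m, hm⟩ : ∃ m, n / 2 = m + 1 := ⟨n / 2 - 1, by omega⟩
        rw [if_neg h1, if_neg]
        simp [loaded, hm, List.range_succ]
    rw [e4, show { P.loaded n [] (s (n / 2) :: (List.range (n / 2)).reverse.map s)
        ((List.range (n / 2)).reverse.map fun i => s (n - 1 - i)) with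
          left := (List.range (n / 2)).reverse.map s } =
        P.loaded n [] ((List.range (n / 2)).reverse.map s)
          ((List.range (n / 2)).reverse.map fun i => s (n - 1 - i)) from rfl, absorb_loaded] at h2
    have h3 := run_pair (P := P) n (List.range (n / 2)).reverse s (fun i => s (n - 1 - i))
      [slicePair n s (n / 2)]
    rw [e1 _ e2, List.singleton_append] at h3
    have e6 : (fun e => P.feasible e (slicePair n s (n / 2))) =
        fun e => [slicePair n s (n / 2)].all (P.feasible e) := by
      funext e
      simp
    rw [e6] at h2
    refine (h1.trans (h2.run h3)).mono ?_
    rw [List.length_reverse, List.length_range]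
    omega
  · have hk' : k = n / 2 := by omega
    have hN : (n + 1) / 2 = n / 2 := by omega
    rw [hk'] at h1
    simp only [hn, decide_false, Bool.false_eq_true, if_false] at h1 ⊢
    have h3 := run_pair (P := P) n (List.range (n / 2)).reverse s (fun i => s (n - 1 - i)) []
    rw [e1 _ e2, List.nil_append] at h3
    rw [hN]
    refine (h1.trans h3).mono ?_
    rw [List.length_reverse, List.length_range]
    omega

end Collect

/-- As long as no feasible counter is zero, subtracting 1 preserves the order among the feasible
ones. The countdown lasts at most as long as the counter of any feasible `e₀`. -/
theorem run_compare (m : ℕ) (f : E → Bool) (S : Store A E P.maxLong) {e₀ : E}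
    (hf : f e₀ = true) (hm : S.count e₀ = m) :
    ∃ e c, f e = true ∧ (∀ e', f e' = true → S.count e ≤ S.count e') ∧
      P.Run (m + 1) (.compare f) S (.tokens e (P.numLong e)) { S with count := c } := by
  by_cases h : ∃ e, f e = true ∧ S.count e = 0
  · obtain ⟨e, h1, h2, h3⟩ := step_compare_found S h
    exact ⟨e, S.count, h1, fun e' _ => h2 ▸ Nat.zero_le _, (h3.run (.refl m _ _))⟩
  · push Not at h
    induction m generalizing S with
    | zero => exact (h e₀ hf hm).elim
    | succ m ih =>
      have h1 := step_compare_step S h ⟨e₀, hf⟩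
      by_cases h' : ∃ e, f e = true ∧ S.count e - 1 = 0
      · obtain ⟨e, k1, k2, k3⟩ := step_compare_found { S with count := fun e => S.count e - 1 } h'
        refine ⟨e, _, k1, fun e' he' => ?_, h1.run (k3.run (.refl m _ _))⟩
        have := h e' he'
        have : S.count e - 1 = 0 := k2
        omega
      · push Not at h'
        obtain ⟨e, c, k1, k2, k3⟩ := ih { S with count := fun e => S.count e - 1 }
          (by simp only; omega) h'
        refine ⟨e, c, k1, fun e' he' => ?_, h1.run k3⟩
        have h2 := k2 e' he'
        have := h e' he'
        simp only at h2
        omega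

section Print

theorem run_emit {e : E} {j : Fin (P.maxLong + 1)} (u : Bool) (m : ℕ) (S : Store A E P.maxLong)
    (hm : S.ticks u = m) :
    P.Run (m + 1) (.emit e j u) S (.restore e j u) { S with
      ticks := update S.ticks u 0
      temp := m + S.temp
      out := OutSym.axis 2 :: (List.replicate m OutSym.tick ++ S.out) } := by
  induction m generalizing S with
  | zero =>
    refine (step_emit_zero S hm).run ((Run.refl 0 _ _).cast ?_)
    simp [← hm]
  | succ m ih =>
    refine (step_emit_succ S hm).run ((ih _ (update_self ..)).cast ?_)
    simp only [update_idem, List.replicate_succ', List.append_assoc, List.singleton_append]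
    congr 1
    omega

theorem run_restore {e : E} {j : Fin (P.maxLong + 1)} (u : Bool) (m : ℕ)
    (S : Store A E P.maxLong) (hm : S.temp = m) :
    P.Run (m + 1) (.restore e j u) S (.tokens e j) { S with
      ticks := update S.ticks u (S.ticks u + m)
      temp := 0 } := by
  induction m generalizing S with
  | zero =>
    refine (step_restore_zero S hm).run ((Run.refl 0 _ _).cast ?_)
    cases S
    simp only at hm
    subst hm
    simp
  | succ m ih =>
    refine (step_restore_succ S hm).run ((ih _ rfl).cast ?_)
    simp only [update_idem, update_self]
    congr 2
    omega

/-- The store while the moves are printed. -/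
def printing (P : SolverData A E) (c : E → ℕ)
    (tk : E → Fin (P.maxLong + 1) → List (Option (Bool × Turn))) (o : List OutSym) (a b : ℕ) :
    Store A E P.maxLong :=
  ⟨[], o, [], [], 0, c, tk, tickPair a b, 0⟩

variable {c : E → ℕ} {tk : E → Fin (P.maxLong + 1) → List (Option (Bool × Turn))}
  {o : List OutSym} {e : E} {j : Fin (P.maxLong + 1)}

/-- The token stacks, with the contents of one of them replaced. -/
def replaceTokens (tk : E → Fin (P.maxLong + 1) → List (Option (Bool × Turn))) (e : E)
    (j : Fin (P.maxLong + 1)) (l : List (Option (Bool × Turn))) :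
    E → Fin (P.maxLong + 1) → List (Option (Bool × Turn)) :=
  update tk e (update (tk e) j l)

theorem replaceTokens_self (l : List (Option (Bool × Turn))) :
    replaceTokens (P := P) tk e j l e j = l := by
  simp [replaceTokens]

theorem replaceTokens_of_ne (l : List (Option (Bool × Turn))) {j' : Fin (P.maxLong + 1)}
    (h : j' ≠ j) : replaceTokens (P := P) tk e j l e j' = tk e j' := by
  simp [replaceTokens, h]

theorem replaceTokens_replaceTokens (l l' : List (Option (Bool × Turn))) :
    replaceTokens (P := P) (replaceTokens (P := P) tk e j l) e j l' =
      replaceTokens (P := P) tk e j l' := by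
  simp [replaceTokens]

theorem run_move {n i : ℕ} (hi : i < n) {m : Bool × Turn} {l : List (Option (Bool × Turn))}
    (h : tk e j = some m :: l) :
    P.Run (2 * n + 3) (.tokens e j) (P.printing c tk o i (n - i)) (.tokens e j)
      (P.printing c (replaceTokens (P := P) tk e j l) (moveCode n i m ++ o) i (n - i)) := by
  obtain ⟨u, t⟩ := m
  cases u
  · have h1 := step_tokens_false (P.printing c tk o i (n - i)) h
    have h2 := run_emit (P := P) (e := e) (j := j) false i (S := { P.printing c tk o i (n - i) with
      tokens := setTokens (P.printing c tk o i (n - i)) e j l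
      out := OutSym.turn t :: o }) rfl
    have h3 := h1.run (h2.trans (run_restore false i _ rfl))
    refine (h3.mono (by omega)).cast ?_
    simp [printing, setTokens, replaceTokens, moveCode]
  · obtain ⟨k, hk⟩ : ∃ k, n - i = k + 1 := ⟨n - i - 1, by omega⟩
    have h1 := step_tokens_true (P.printing c tk o i (n - i)) h (i := k) hk
    have h2 := run_emit (P := P) (e := e) (j := j) true k (S := { P.printing c tk o i (n - i) with
      tokens := setTokens (P.printing c tk o i (n - i)) e j l
      out := OutSym.turn t :: o
      ticks := update (P.printing c tk o i (n - i)).ticks true k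
      temp := 1 }) rfl
    have h3 := h1.run (h2.trans (run_restore true (k + 1) _ rfl))
    refine (h3.mono (by omega)).cast ?_
    have e1 : n - 1 - i = k := by omega
    simp [printing, setTokens, replaceTokens, moveCode, e1, hk]

/-- Printing onto a stack reverses the moves, which is why `tokenBlock` stores them reversed. The
closing `none` passes one tick on, as needed for cluster i+1. -/
theorem run_moves {n i : ℕ} (hi : i < n) (ms : List (Bool × Turn))
    {l : List (Option (Bool × Turn))} (h : tk e j = ms.map some ++ none :: l) :
    P.Run (ms.length * (2 * n + 3) + 1) (.tokens e j) (P.printing c tk o i (n - i)) (.tokens e j)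
      (P.printing c (replaceTokens (P := P) tk e j l) (ms.reverse.flatMap (moveCode n i) ++ o)
        (i + 1) (n - (i + 1))) := by
  induction ms generalizing tk o with
  | nil =>
    refine (step_tokens_none (P.printing c tk o i (n - i)) h (i := n - (i + 1))
      (by simp [printing]; omega)).run ((Run.refl _ _ _).cast ?_)
    simp [printing, setTokens, replaceTokens]
    rfl
  | cons m ms ih =>
    have h1 := run_move (c := c) (o := o) hi h
    have h2 := ih (tk := replaceTokens (P := P) tk e j (ms.map some ++ none :: l))
      (o := moveCode n i m ++ o) (replaceTokens_self _)
    rw [replaceTokens_replaceTokens] at h2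
    refine ((h1.trans h2).mono ?_).cast ?_
    · rw [List.length_cons, Nat.add_mul]
      omega
    · simp [printing]

theorem run_clusters {n R : ℕ} (x : ℕ → Kind × A × A) (hR : ∀ x, (P.moves e j x).length ≤ R)
    (k i : ℕ) (hk : i + k ≤ n)
    (h : tk e j = ((List.range' i k).map x).flatMap (P.tokenBlock e j)) :
    P.Run (k * (R * (2 * n + 3) + 1)) (.tokens e j) (P.printing c tk o i (n - i)) (.tokens e j)
      (P.printing c (replaceTokens (P := P) tk e j [])
        (((List.range' i k).reverse.flatMap fun i => (P.moves e j (x i)).flatMap (moveCode n i)) ++ o)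
        (i + k) (n - (i + k))) := by
  induction k generalizing i tk o with
  | zero =>
    refine (Run.refl _ _ _).cast ?_
    have : replaceTokens (P := P) tk e j [] = tk := by
      have h' : tk e j = [] := h
      rw [replaceTokens, ← h', update_eq_self, update_eq_self]
    simp [this]
  | succ k ih =>
    rw [List.range'_succ, List.map_cons, List.flatMap_cons, tokenBlock, List.append_assoc,
      List.singleton_append] at h
    have h1 := run_moves (c := c) (o := o) (n := n) (i := i) (by omega) _ h
    have h2 := ih (i + 1) (tk := replaceTokens (P := P) tk e j _) (by omega)
      (replaceTokens_self _)
      (o := (P.moves e j (x i)).reverse.reverse.flatMap (moveCode n i) ++ o)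
    rw [replaceTokens_replaceTokens] at h2
    refine ((h1.trans h2).mono ?_).cast ?_
    · rw [List.length_reverse, Nat.add_mul k]
      have := Nat.mul_le_mul_right (2 * n + 3) (hR (x i))
      omega
    · rw [show i + 1 + k = i + (k + 1) by omega]
      simp [List.range'_succ]

theorem run_reset (i b : ℕ) :
    P.Run i (.reset e j) (P.printing c tk o i b) (.reset e j) (P.printing c tk o 0 (b + i)) := by
  induction i generalizing b with
  | zero => exact Run.refl _ _ _
  | succ i ih =>
    refine (step_reset_succ _ (i := i) rfl).run (((ih (b + 1)).cast ?_))
    rw [show b + 1 + i = b + (i + 1) by omega]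

/-- The code of the short moves in one segment of a candidate solution. -/
def segmentCode (P : SolverData A E) (n N : ℕ) (x : ℕ → Kind × A × A) (e : E) (j : ℕ) :
    List OutSym :=
  (List.range N).reverse.flatMap fun i => (P.moves e j (x i)).flatMap (moveCode n i)

/-- The code of the first `j` long moves of a candidate solution and the short moves before and
between them and directly after them. -/
def prefixCode (P : SolverData A E) (n N : ℕ) (x : ℕ → Kind × A × A) (e : E) :
    ℕ → List OutSym :=
  alternate (P.segmentCode n N x e) (P.longCode e)

/-- The segments are printed from the last to the first. Only the token stacks up to `j` are still
to be read, so nothing is assumed about the others, which have been emptied or were never needed. -/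
theorem run_print {n N R : ℕ} (hN : N ≤ n) (x : ℕ → Kind × A × A)
    (hR : ∀ j x, (P.moves e j x).length ≤ R) (j : ℕ) (hj : j < P.maxLong + 1)
    (h : ∀ j' : Fin (P.maxLong + 1), (j' : ℕ) ≤ j →
      tk e j' = ((List.range N).map x).flatMap (P.tokenBlock e j')) :
    ∃ tk', P.Run ((j + 1) * (N * (R * (2 * n + 3) + 1) + N + 2)) (.tokens e ⟨j, hj⟩)
      (P.printing c tk o 0 n) .clean
      (P.printing c tk' (P.prefixCode n N x e j ++ o) 0 n) := by
  have key : ∀ (j : ℕ) (hj : j < P.maxLong + 1) tk o,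
      (tk e ⟨j, hj⟩ = ((List.range N).map x).flatMap (P.tokenBlock e j)) →
      P.Run (N * (R * (2 * n + 3) + 1) + N + 1) (.tokens e ⟨j, hj⟩) (P.printing c tk o 0 n)
        (.reset e ⟨j, hj⟩) (P.printing c (replaceTokens (P := P) tk e ⟨j, hj⟩ [])
          (P.segmentCode n N x e j ++ o) 0 n) := by
    intro j hj tk o h
    have h1 := run_clusters (P := P) (c := c) (o := o) (n := n) x (hR j) N 0 (by omega)
      (by rwa [← List.range_eq_range'])
    rw [← List.range_eq_range', Nat.zero_add] at h1
    have h2 := (step_tokens_nil (P.printing c (replaceTokens (P := P) tk e ⟨j, hj⟩ [])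
      (P.segmentCode n N x e j ++ o) N (n - N)) (replaceTokens_self _)).run (run_reset N (n - N))
    rw [Nat.sub_add_cancel hN] at h2
    exact (h1.trans h2).mono (by omega)
  induction j generalizing tk o with
  | zero =>
    have h1 := key 0 hj tk o (h _ le_rfl)
    exact ⟨_, (h1.trans ((step_reset_last _ rfl rfl).run (.refl 0 _ _))).mono (by omega)⟩
  | succ j ih =>
    have h1 := key (j + 1) hj tk o (h _ le_rfl)
    obtain ⟨tk', h2⟩ := ih (tk := replaceTokens (P := P) tk e ⟨j + 1, hj⟩ [])
      (o := P.longCode e j ++ (P.segmentCode n N x e (j + 1) ++ o)) (by omega) fun j' hj' => by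
        rw [replaceTokens_of_ne _ (fun h => by rw [h] at hj'; simp at hj')]
        exact h j' (by omega)
    refine ⟨tk', ((h1.trans ((step_reset_zero _ hj rfl).run h2)).mono ?_).cast ?_⟩
    · rw [Nat.add_mul (j + 1)]
      omega
    · simp [prefixCode, alternate]

end Print
end SolverData
end RubikCube

/-! ### Correctness and running time of the solving machine -/

namespace RubikCube
open Function

/-- This bounds the cleaning phase without any record of what printing has left on the stacks. -/
theorem StackMachine.Runs.length_le {K Q : Type} {Γ : K → Type} {M : StackMachine K Γ Q} {r T : ℕ}
    (hr : ∀ q tops k, (M.push q tops k).length ≤ r) {c c' : Q × ∀ k, List (Γ k)}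
    (h : M.Runs T c c') (k : K) : (c'.2 k).length ≤ (c.2 k).length + r * T := by
  induction h with
  | refl => omega
  | @step T c c' _ _ ih =>
    have h1 : ((M.stepTo c).2 k).length ≤ r + (c.2 k).length := by
      simp only [StackMachine.stepTo, List.length_append, List.length_tail]
      have := hr c.1 (fun k => (c.2 k).head?) k
      omega
    rw [Nat.mul_succ]
    omega

namespace SolverData
variable {A E : Type} [DecidableEq E] {P : SolverData A E}

/-- The length of a candidate solution. -/
def totalCost (P : SolverData A E) (N : ℕ) (x : ℕ → Kind × A × A) (e : E) : ℕ :=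
  P.numLong e + ∑ i ∈ Finset.range N, P.cost e (x i)

/-- A bound on the time until the answer has been printed, in terms of bounds on the numbers of
short moves. -/
def printTime (P : SolverData A E) (R B n : ℕ) : ℕ :=
  n * P.blockLength + 2 * n + 5 + (P.maxLong + n * B + 1) +
    (P.maxLong + 1) * (n * (R * (2 * n + 3) + 1) + n + 2)

/-- The store at the beginning. -/
def initial (P : SolverData A E) (inp : List (Option Color)) : Store A E P.maxLong :=
  ⟨inp, [], [], [], 0, fun _ => 0, fun _ _ => [], tickPair 0 0, 0⟩

theorem sum_map_reverse_range (N : ℕ) (x : ℕ → Kind × A × A) (f : Kind × A × A → ℕ) :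
    ((((List.range N).reverse.map x).map f).sum) = ∑ i ∈ Finset.range N, f (x i) := by
  rw [List.map_map, List.map_reverse, List.sum_reverse]
  rfl

variable (enc : A → List (Option Color)) (hb : 0 < P.blockLength)
  (hlen : ∀ a, (enc a).length = P.blockLength) (hdec : ∀ a, P.decode (enc a) = a)
  {R B : ℕ} (hR : ∀ e j x, (P.moves e j x).length ≤ R) (hB : ∀ e x, P.cost e x ≤ B)
  (n : ℕ) (s : ℕ → A)

include hb hlen hdec in
theorem run_toCompare :
    P.Run (n * P.blockLength + 2 * n + 5) (.read ⟨[], Nat.zero_le _⟩ false)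
      (P.initial (((List.range n).map s).flatMap enc))
      (.compare fun e => ((List.range ((n + 1) / 2)).reverse.map (slicePair n s)).all
        (P.feasible e))
      { P.loaded n ((List.range ((n + 1) / 2)).reverse.map (slicePair n s)) [] [] with
        count := P.totalCost ((n + 1) / 2) (slicePair n s) } := by
  have h1 := run_read hb enc hlen hdec ((List.range n).map s) [] 0
  rw [List.length_map, List.length_range, List.append_nil, Nat.zero_add] at h1
  have h2 := h1.trans (run_collect n s)
  simp only [sum_map_reverse_range] at h2
  exact h2.mono (by omega)

include hb hlen hdec hR hB in
theorem exists_run_solution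
    (hf : ∃ e, ∀ i < (n + 1) / 2, P.feasible e (slicePair n s i) = true) :
    ∃ e, (∀ i < (n + 1) / 2, P.feasible e (slicePair n s i) = true) ∧
      (∀ e', (∀ i < (n + 1) / 2, P.feasible e' (slicePair n s i) = true) →
        P.totalCost ((n + 1) / 2) (slicePair n s) e ≤
          P.totalCost ((n + 1) / 2) (slicePair n s) e') ∧
      ∃ S, S.out = P.prefixCode n ((n + 1) / 2) (slicePair n s) e (P.numLong e) ∧
        P.Run (P.printTime R B n) (.read ⟨[], Nat.zero_le _⟩ false)
          (P.initial (((List.range n).map s).flatMap enc)) .clean S := by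
  have h1 := run_toCompare enc hb hlen hdec n s
  have hf' : ∀ e, ((List.range ((n + 1) / 2)).reverse.map (slicePair n s)).all (P.feasible e) =
      true ↔ ∀ i < (n + 1) / 2, P.feasible e (slicePair n s i) = true := by
    intro e
    simp
  obtain ⟨e₀, he₀⟩ := hf
  obtain ⟨e, c, k1, k2, k3⟩ := run_compare _
    (fun e => ((List.range ((n + 1) / 2)).reverse.map (slicePair n s)).all (P.feasible e))
    { P.loaded n ((List.range ((n + 1) / 2)).reverse.map (slicePair n s)) [] [] with
      count := P.totalCost ((n + 1) / 2) (slicePair n s) } ((hf' e₀).2 he₀) rfl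
  refine ⟨e, (hf' e).1 k1, fun e' he' => k2 e' ((hf' e').2 he'), ?_⟩
  have hN : (n + 1) / 2 ≤ n := by omega
  obtain ⟨tk', k4⟩ := run_print (P := P) (c := c) (o := []) (e := e) hN (slicePair n s) (hR e)
    (P.numLong e) (P.numLong e).2
    (tk := fun e j => ((List.range ((n + 1) / 2)).map (slicePair n s)).flatMap (P.tokenBlock e j))
    (fun _ _ => rfl)
  refine ⟨_, List.append_nil _, ((h1.trans k3).trans (Run.trans (T := 0) ?_ k4)).mono ?_⟩
  · refine (Run.refl 0 _ _).cast ?_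
    simp only [loaded, printing, List.map_reverse, List.reverse_reverse]
  -- The length of the countdown: at most `P.maxLong` long moves, and at most n clusters of cost at
  -- most `B`.
  · have c1 : P.totalCost ((n + 1) / 2) (slicePair n s) e₀ ≤ P.maxLong + n * B := by
      have := Finset.sum_le_card_nsmul (Finset.range ((n + 1) / 2))
        (fun i => P.cost e₀ (slicePair n s i)) B fun i _ => hB _ _
      rw [Finset.card_range, smul_eq_mul] at this
      have := Nat.mul_le_mul_right B hN
      have := (P.numLong e₀).2
      rw [totalCost]
      omega
    have c2 : ((P.numLong e : ℕ) + 1) *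
        ((n + 1) / 2 * (R * (2 * n + 3) + 1) + (n + 1) / 2 + 2) ≤
        (P.maxLong + 1) * (n * (R * (2 * n + 3) + 1) + n + 2) := by
      have := (P.numLong e).2
      have := Nat.mul_le_mul_right (R * (2 * n + 3) + 1) hN
      exact Nat.mul_le_mul (by omega) (by omega)
    simp only [printTime]
    omega

include hb hlen hdec in
theorem exists_run_unsolvable
    (hf : ¬ ∃ e, ∀ i < (n + 1) / 2, P.feasible e (slicePair n s i) = true) :
    ∃ S, S.out = [OutSym.unsolvable] ∧
      P.Run (P.printTime R B n) (.read ⟨[], Nat.zero_le _⟩ false)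
        (P.initial (((List.range n).map s).flatMap enc)) .clean S := by
  have h1 := run_toCompare enc hb hlen hdec n s
  have hf' : ∀ e, ((List.range ((n + 1) / 2)).reverse.map (slicePair n s)).all (P.feasible e) =
      false := by
    intro e
    by_contra h
    exact hf ⟨e, by simpa using h⟩
  refine ⟨_, ?_, (h1.trans ((step_compare_none _ hf').run (.refl 0 _ _))).mono ?_⟩
  · rfl
  · simp only [printTime]
    omega

theorem machine_outputs [Inhabited A]
    [Fintype (Stack E P.maxLong)] [Fintype (State P.blockLength E P.maxLong)]
    [∀ k, Fintype (Alphabet A E P.maxLong k)] {r T : ℕ}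
    (hr : ∀ q tops k, (P.machine.push q tops k).length ≤ r)
    {inp : List (Option Color)} {S : Store A E P.maxLong}
    (h : P.Run T (.read ⟨[], Nat.zero_le _⟩ false) (P.initial inp) .clean S) :
    Nonempty (Turing.TM2OutputsInTime P.machine.toFinTM2 inp (some S.out)
      (T + (inp.length + r * T + 1) + 1)) := by
  have h1 := runs_clean (P := P) (inp.length + r * T) S.stacks fun k _ => by
    refine (StackMachine.Runs.length_le hr h k).trans (Nat.add_le_add_right ?_ _)
    cases k with
    | inp => exact le_rfl
    | ticks u => cases u <;> exact Nat.zero_le _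
    | _ => exact Nat.zero_le _
  refine (StackMachine.Runs.trans h h1).outputs rfl (fun k hk => ?_) fun k hk =>
    outOnly_of_ne _ hk
  cases k with
  | inp => exact (hk rfl).elim
  | ticks u => cases u <;> rfl
  | _ => rfl

end SolverData
end RubikCube

/-! ### The machine for the cube -/

namespace RubikCube
open Function

variable {c₁ c₂ n : ℕ}

/-- The code of a long move. -/
def longMoveCode : LongMove c₁ c₂ → List OutSym
  | Sum.inl k => OutSym.axis 0 :: (List.replicate k.1 OutSym.tick ++ [OutSym.turn Turn.half])
  | Sum.inr k => OutSym.axis 1 :: (List.replicate k.1 OutSym.tick ++ [OutSym.turn Turn.half])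

/-- The code of a move of the clusters. -/
def actCode {N : ℕ} (n : ℕ) : LongMove c₁ c₂ ⊕ (Fin N × ShortMove c₁ c₂) → List OutSym
  | Sum.inl l => longMoveCode l
  | Sum.inr (i, s) => moveCode n i (s.1, s.2.1)

theorem Represents.encodeMove_eq {m : Move (dims c₁ c₂ n)}
    {a : LongMove c₁ c₂ ⊕ (Fin ((n + 1) / 2) × ShortMove c₁ c₂)} (h : Represents m a) :
    encodeMove m = actCode n a := by
  rcases a with (k | k) | ⟨i, u, t⟩ <;> obtain ⟨h1, h2, h3⟩ := h <;>
    rw [encodeMove, h1, h2, h3] <;> rfl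

theorem flatMap_encodeMove {s : List (Move (dims c₁ c₂ n))}
    {u : List (LongMove c₁ c₂ ⊕ (Fin ((n + 1) / 2) × ShortMove c₁ c₂))}
    (h : List.Forall₂ Represents s u) : s.flatMap encodeMove = u.flatMap (actCode n) := by
  induction h with
  | nil => rfl
  | cons h _ ih => rw [List.flatMap_cons, List.flatMap_cons, h.encodeMove_eq, ih]

instance : Finite (Slice c₁ c₂) :=
  inferInstanceAs (Finite (Fin c₁ → Fin c₂ → Fin 3 → Bool → Option Color))

noncomputable instance : Fintype (ClusterState c₁ c₂) :=
  haveI : Finite (Slice c₁ c₂ × Slice c₁ c₂) := inferInstance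
  Fintype.ofFinite (Kind × Slice c₁ c₂ × Slice c₁ c₂)

/-- The target colorings. -/
abbrev Target : Type := {t : Fin 3 × Bool → Color // Injective t}

/-- The possible profiles of sequences of long moves. -/
abbrev Profile (c₁ c₂ : ℕ) : Type :=
  Target → ClusterState c₁ c₂ → Set (Fin (Fintype.card (ClusterState c₁ c₂)))

/-- There are only finitely many profiles. This is the source of the bound on long moves. -/
theorem exists_shortest_bound (c₁ c₂ : ℕ) :
    ∃ J, ∀ p : Profile c₁ c₂, ((cubeSystem c₁ c₂).shortest p).length ≤ J := by
  obtain ⟨J, hJ⟩ := (Set.finite_range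
    fun p : Profile c₁ c₂ => ((cubeSystem c₁ c₂).shortest p).length).bddAbove
  exact ⟨J, fun p => hJ ⟨p, rfl⟩⟩

/-- The data of the solving machine for the `c₁ × c₂ × n` cubes. -/
noncomputable def cubeSolver (c₁ c₂ : ℕ) : SolverData (Slice c₁ c₂) (Profile c₁ c₂ × Target) where
  blockLength := c₁ * (c₂ * 6)
  decode := invFun encodeSlice
  maxLong := (exists_shortest_bound c₁ c₂).choose
  numLong e := ⟨((cubeSystem c₁ c₂).shortest e.1).length,
    Nat.lt_succ_of_le ((exists_shortest_bound c₁ c₂).choose_spec e.1)⟩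
  longCode e j := (((cubeSystem c₁ c₂).shortest e.1)[j]?).elim [] longMoveCode
  -- No algorithm for these functions is needed: the candidates and cluster states form finite sets
  -- independent of n, so the values are constants of the control.
  feasible e x := open Classical in
    decide (∃ c, (cubeSystem c₁ c₂).Attains ((cubeSystem c₁ c₂).shortest e.1) e.2 x c)
  cost e x := (cubeSystem c₁ c₂).minCost ((cubeSystem c₁ c₂).shortest e.1) e.2 x
  moves e j x := (segment ((cubeSystem c₁ c₂).plan ((cubeSystem c₁ c₂).shortest e.1) e.2 x) j).map
    fun s => (s.1, s.2.1)

theorem length_segment_le {L S : Type} (v : List (L ⊕ S)) (j : ℕ) :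
    (segment v j).length ≤ v.length := by
  induction v generalizing j with
  | nil => simp [segment]
  | cons a v ih =>
    rcases a with l | s <;> cases j <;> simp only [segment, List.length_cons, List.length_nil] <;>
      first
      | omega
      | exact Nat.add_le_add_right (ih _) 1
      | exact (ih _).trans (Nat.le_succ _)

theorem exists_moves_bound (c₁ c₂ : ℕ) :
    ∃ R, ∀ e j x, ((cubeSolver c₁ c₂).moves e j x).length ≤ R := by
  obtain ⟨R, hR⟩ := (Set.finite_range fun p : (Profile c₁ c₂ × Target) × ClusterState c₁ c₂ =>
    ((cubeSystem c₁ c₂).plan ((cubeSystem c₁ c₂).shortest p.1.1) p.1.2 p.2).length).bddAbove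
  refine ⟨R, fun e j x => ?_⟩
  simp only [cubeSolver, List.length_map]
  exact (length_segment_le _ _).trans (hR ⟨(e, x), rfl⟩)

theorem exists_cost_bound (c₁ c₂ : ℕ) : ∃ B, ∀ e x, (cubeSolver c₁ c₂).cost e x ≤ B := by
  obtain ⟨B, hB⟩ := (Set.finite_range fun p : (Profile c₁ c₂ × Target) × ClusterState c₁ c₂ =>
    (cubeSolver c₁ c₂).cost p.1 p.2).bddAbove
  exact ⟨B, fun e x => hB ⟨(e, x), rfl⟩⟩

theorem alternate_famSegment {L S ι β : Type} (code : L ⊕ (ι × S) → List β) (is : List ι)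
    (w : List L) (h : ι → ℕ → List S) :
    alternate (fun j => (famSegment is fun i => h i j).flatMap code)
      (fun j => (w[j]?).elim [] fun l => code (Sum.inl l)) w.length =
        (famInterleave is w h).flatMap code := by
  induction w generalizing h with
  | nil => rfl
  | cons l w ih =>
    rw [List.length_cons, alternate_succ, famInterleave, List.flatMap_append, List.flatMap_cons,
      ← ih]
    rfl

theorem map_val_finRange (N : ℕ) : (List.finRange N).map Fin.val = List.range N :=
  List.ext_getElem (by simp) (by simp)

/-- The order of the clusters within a segment is free. The reversed list is the order in which they
stand in the machine's output. -/
theorem segmentCode_eq (C : Config (dims c₁ c₂ n)) (e : Profile c₁ c₂ × Target) (j : ℕ) :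
    (cubeSolver c₁ c₂).segmentCode n ((n + 1) / 2) (slicePair n (sliceOf C)) e j =
      (famSegment (List.finRange ((n + 1) / 2)).reverse fun i =>
        segment ((cubeSystem c₁ c₂).plan ((cubeSystem c₁ c₂).shortest e.1) e.2 (clusters C i))
          j).flatMap (actCode n) := by
  rw [SolverData.segmentCode, ← map_val_finRange, ← List.map_reverse, List.flatMap_map, famSegment,
    List.flatMap_assoc]
  refine flatMap_congr_of_mem fun i _ => ?_
  simp only [cubeSolver, List.flatMap_map]
  rfl

theorem prefixCode_eq (C : Config (dims c₁ c₂ n)) (e : Profile c₁ c₂ × Target) :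
    (cubeSolver c₁ c₂).prefixCode n ((n + 1) / 2) (slicePair n (sliceOf C)) e
        ((cubeSolver c₁ c₂).numLong e) =
      ((cubeSystem c₁ c₂).candidate (List.finRange ((n + 1) / 2)).reverse
        ((cubeSystem c₁ c₂).shortest e.1) e.2 (clusters C)).flatMap (actCode n) := by
  rw [ClusterSystem.candidate, ← alternate_famSegment, SolverData.prefixCode]
  congr 1
  funext j
  exact segmentCode_eq C e j

theorem feasible_iff (C : Config (dims c₁ c₂ n)) (e : Profile c₁ c₂ × Target) :
    (∀ i < (n + 1) / 2, (cubeSolver c₁ c₂).feasible e (slicePair n (sliceOf C) i) = true) ↔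
      ∀ i, ∃ c, (cubeSystem c₁ c₂).Attains ((cubeSystem c₁ c₂).shortest e.1) e.2
        (clusters C i) c := by
  simp only [cubeSolver, decide_eq_true_eq]
  exact ⟨fun h i => h i i.2, fun h i hi => h ⟨i, hi⟩⟩

theorem totalCost_eq (C : Config (dims c₁ c₂ n)) (e : Profile c₁ c₂ × Target) :
    (cubeSolver c₁ c₂).totalCost ((n + 1) / 2) (slicePair n (sliceOf C)) e =
      ((cubeSystem c₁ c₂).shortest e.1).length + ∑ i, (cubeSystem c₁ c₂).minCost
        ((cubeSystem c₁ c₂).shortest e.1) e.2 (clusters C i) := by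
  rw [SolverData.totalCost, Finset.sum_range]
  rfl

/-- The lower bound for all solutions: the profile of a solution's long moves, with a target that it
reaches, is a candidate that costs no more. It also shows that without feasible candidates there is
no solution. -/
theorem IsSolution.exists_feasible (h₁ : c₁ ≠ n) (h₂ : n ≠ c₂) {C : Config (dims c₁ c₂ n)}
    {s : List (Move (dims c₁ c₂ n))} (h : IsSolution C s) :
    ∃ e, (∀ i < (n + 1) / 2, (cubeSolver c₁ c₂).feasible e (slicePair n (sliceOf C) i) = true) ∧
      (cubeSolver c₁ c₂).totalCost ((n + 1) / 2) (slicePair n (sliceOf C)) e ≤ s.length := by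
  obtain ⟨u, hu, hsol⟩ := exists_famSolves h₁ h₂ h
  obtain ⟨t, k1, -, k3⟩ := hsol.exists_candidate_le
  refine ⟨((cubeSystem c₁ c₂).profile (longs u), t), (feasible_iff C _).2 k1, ?_⟩
  rw [totalCost_eq, hu.length_eq, length_eq u, ← sum_cost_proj]
  exact Nat.add_le_add ((cubeSystem c₁ c₂).length_shortest_le (longs u))
    (Finset.sum_le_sum fun i _ => k3 i)

theorem exists_isAnswer_of_feasible (h₁ : c₁ ≠ n) (h₂ : n ≠ c₂) (C : Config (dims c₁ c₂ n))
    {e : Profile c₁ c₂ × Target}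
    (he : ∀ i < (n + 1) / 2, (cubeSolver c₁ c₂).feasible e (slicePair n (sliceOf C) i) = true)
    (hmin : ∀ e', (∀ i < (n + 1) / 2,
      (cubeSolver c₁ c₂).feasible e' (slicePair n (sliceOf C) i) = true) →
        (cubeSolver c₁ c₂).totalCost ((n + 1) / 2) (slicePair n (sliceOf C)) e ≤
          (cubeSolver c₁ c₂).totalCost ((n + 1) / 2) (slicePair n (sliceOf C)) e') :
    ∃ r, IsAnswer C r ∧ encodeAnswer r = (cubeSolver c₁ c₂).prefixCode n ((n + 1) / 2)
      (slicePair n (sliceOf C)) e ((cubeSolver c₁ c₂).numLong e) := by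
  obtain ⟨k1, k2⟩ := (cubeSystem c₁ c₂).candidate_spec
    (List.nodup_reverse.2 (List.nodup_finRange ((n + 1) / 2)))
    (fun i => List.mem_reverse.2 (List.mem_finRange i)) ((feasible_iff C e).1 he)
  obtain ⟨s, hs, hsol⟩ := k1.exists_isSolution h₁ h₂
  refine ⟨some s, ⟨hsol, fun s' hs' => ?_⟩, ?_⟩
  · obtain ⟨e', he', hle⟩ := hs'.exists_feasible h₁ h₂
    rw [hs.length_eq, k2, ← totalCost_eq]
    exact (hmin e' he').trans hle
  · rw [prefixCode_eq]
    exact flatMap_encodeMove hs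

theorem optimal_bounds (h₁ : c₁ ≠ n) (h₂ : n ≠ c₂) {C : Config (dims c₁ c₂ n)}
    {s : List (Move (dims c₁ c₂ n))} (h : IsOptimalSolution C s) {J : ℕ}
    (hJ : ∀ p : Profile c₁ c₂, ((cubeSystem c₁ c₂).shortest p).length ≤ J) :
    (∀ i < n, shortMoves i s ≤ Fintype.card (ClusterState c₁ c₂)) ∧ longMoves s ≤ J := by
  obtain ⟨u, hu, hsol⟩ := exists_famSolves h₁ h₂ h.1
  obtain ⟨k1, k2⟩ := hsol.bounds hJ fun u' hu' => by
    obtain ⟨s', hs', hsol'⟩ := hu'.exists_isSolution h₁ h₂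
    rw [← hu.length_eq, ← hs'.length_eq]
    exact h.2 s' hsol'
  refine ⟨fun i hi => ?_, (longMoves_eq hu).trans_le k2⟩
  -- A height in the upper half belongs to the cluster of its mirror height.
  by_cases hi' : i < (n + 1) / 2
  · exact (shortMoves_eq hu hi (i := ⟨i, hi'⟩) (Or.inl rfl)).trans_le (k1 _)
  · exact (shortMoves_eq hu hi (i := ⟨n - 1 - i, by omega⟩) (Or.inr rfl)).trans_le (k1 _)

/-- The running time of the solving machine as a polynomial. -/
noncomputable def timePolynomial (b J R B r : ℕ) : Polynomial ℕ :=
  let X : Polynomial ℕ := Polynomial.X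
  let T : Polynomial ℕ := X * b + 2 * X + 5 + (J + X * B + 1) +
    (J + 1) * (X * (R * (2 * X + 3) + 1) + X + 2)
  T + (X * b + r * T + 1) + 1

theorem eval_timePolynomial {A E : Type} (P : SolverData A E) (R B r n : ℕ) :
    (timePolynomial P.blockLength P.maxLong R B r).eval n =
      P.printTime R B n + (n * P.blockLength + r * P.printTime R B n + 1) + 1 := by
  simp [timePolynomial, SolverData.printTime]

theorem length_encodeConfig (C : Config (dims c₁ c₂ n)) :
    (encodeConfig C).length = n * (c₁ * (c₂ * 6)) := by
  rw [encodeConfig_eq, length_flatMap_const _ fun z => length_encodeSlice _, List.length_range]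

noncomputable instance {E : Type} [Finite E] (J : ℕ) : Fintype (Stack E J) := Fintype.ofFinite _

noncomputable instance {E : Type} [Finite E] (b J : ℕ) : Fintype (State b E J) :=
  Fintype.ofFinite _

noncomputable instance {A E : Type} [Finite A] (J : ℕ) (k : Stack E J) :
    Fintype (Alphabet A E J k) := Fintype.ofFinite _

open Classical in
/-- The Turing machine that solves the `c₁ × c₂ × n` cubes. -/
noncomputable def cubeMachine (c₁ c₂ : ℕ) : Turing.TM2ComputableAux (Option Color) OutSym where
  tm := (cubeSolver c₁ c₂).machine.toFinTM2
  inputAlphabet := Equiv.refl _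
  outputAlphabet := Equiv.refl _

theorem cubeMachine_spec (hc₁ : 0 < c₁) (hc₂ : 0 < c₂) :
    ∃ time : Polynomial ℕ, ∀ n, c₁ ≠ n → n ≠ c₂ → ∀ C : Config (dims c₁ c₂ n),
      ∃ r, IsAnswer C r ∧ Nonempty (Turing.TM2OutputsInTime (cubeMachine c₁ c₂).tm
        (encodeConfig C) (some (encodeAnswer r)) (time.eval n)) := by
  classical
  obtain ⟨R, hR⟩ := exists_moves_bound c₁ c₂
  obtain ⟨B, hB⟩ := exists_cost_bound c₁ c₂
  obtain ⟨r, hr⟩ := (cubeSolver c₁ c₂).machine.exists_push_bound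
  refine ⟨timePolynomial (cubeSolver c₁ c₂).blockLength (cubeSolver c₁ c₂).maxLong R B r,
    fun n h₁ h₂ C => ?_⟩
  have hb : 0 < (cubeSolver c₁ c₂).blockLength := Nat.mul_pos hc₁ (Nat.mul_pos hc₂ (by norm_num))
  have hdec : ∀ S, (cubeSolver c₁ c₂).decode (encodeSlice S) = S :=
    leftInverse_invFun encodeSlice_injective
  have henc : encodeConfig C = ((List.range n).map (sliceOf C)).flatMap encodeSlice := by
    rw [encodeConfig_eq, List.flatMap_map]
  have hlen : (encodeConfig C).length = n * (cubeSolver c₁ c₂).blockLength :=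
    length_encodeConfig C
  have out : ∀ S, (cubeSolver c₁ c₂).Run ((cubeSolver c₁ c₂).printTime R B n)
      (.read ⟨[], Nat.zero_le _⟩ false) ((cubeSolver c₁ c₂).initial (encodeConfig C)) .clean S →
      Nonempty (Turing.TM2OutputsInTime (cubeMachine c₁ c₂).tm (encodeConfig C) (some S.out)
        ((timePolynomial (cubeSolver c₁ c₂).blockLength (cubeSolver c₁ c₂).maxLong R B r).eval
          n)) := by
    intro S hS
    have h := SolverData.machine_outputs hr hS
    rw [hlen, ← eval_timePolynomial] at h
    exact h
  by_cases hf : ∃ e, ∀ i < (n + 1) / 2,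
      (cubeSolver c₁ c₂).feasible e (slicePair n (sliceOf C) i) = true
  · obtain ⟨e, he, hmin, S, hS, hrun⟩ := SolverData.exists_run_solution encodeSlice hb
      length_encodeSlice hdec hR hB n (sliceOf C) hf
    obtain ⟨a, ha, ha'⟩ := exists_isAnswer_of_feasible h₁ h₂ C he hmin
    refine ⟨a, ha, ?_⟩
    rw [ha', ← hS]
    exact out S (henc ▸ hrun)
  · obtain ⟨S, hS, hrun⟩ := SolverData.exists_run_unsolvable (R := R) (B := B) encodeSlice hb
      length_encodeSlice hdec n (sliceOf C) hf
    refine ⟨none, fun s hs => hf ?_, ?_⟩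
    · obtain ⟨e, he, -⟩ := hs.exists_feasible h₁ h₂
      exact ⟨e, he⟩
    · rw [encodeAnswer, ← hS]
      exact out S (henc ▸ hrun)

end RubikCube

theorem mainTheorem6 (c₁ c₂ : ℕ) (hc₁ : 0 < c₁) (hc₂ : 0 < c₂) :
    -- the structure of optimal solutions
    (∃ boundShort boundLong : ℕ, ∀ n : ℕ, 0 < n → c₁ ≠ n → n ≠ c₂ →
      ∀ (C : RubikCube.Config (RubikCube.dims c₁ c₂ n))
        (s : List (RubikCube.Move (RubikCube.dims c₁ c₂ n))),
        RubikCube.IsOptimalSolution C s →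
          (∀ i < n, RubikCube.shortMoves i s ≤ boundShort) ∧
          RubikCube.longMoves s ≤ boundLong) ∧
    -- one machine answers all configurations for all `n`, in time polynomial in `n`
    (∃ (M : Turing.TM2ComputableAux (Option RubikCube.Color) RubikCube.OutSym)
        (time : Polynomial ℕ),
      ∀ n : ℕ, 0 < n → c₁ ≠ n → n ≠ c₂ →
        ∀ C : RubikCube.Config (RubikCube.dims c₁ c₂ n),
          ∃ r : Option (List (RubikCube.Move (RubikCube.dims c₁ c₂ n))),
            RubikCube.IsAnswer C r ∧
            Nonempty (Turing.TM2OutputsInTime M.tm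
              ((RubikCube.encodeConfig C).map M.inputAlphabet.symm)
              (some ((RubikCube.encodeAnswer r).map M.outputAlphabet.symm))
              (time.eval n))) := by
  constructor
  · obtain ⟨J, hJ⟩ := RubikCube.exists_shortest_bound c₁ c₂
    exact ⟨_, J, fun n _ h₁ h₂ C s h => RubikCube.optimal_bounds h₁ h₂ h hJ⟩
  · obtain ⟨time, h⟩ := RubikCube.cubeMachine_spec hc₁ hc₂
    refine ⟨RubikCube.cubeMachine c₁ c₂, time, fun n _ h₁ h₂ C => ?_⟩
    obtain ⟨r, hr, h⟩ := h n h₁ h₂ C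
    refine ⟨r, hr, ?_⟩
    have e1 : (RubikCube.encodeConfig C).map (RubikCube.cubeMachine c₁ c₂).inputAlphabet.symm =
        RubikCube.encodeConfig C := List.map_id _
    have e2 : (RubikCube.encodeAnswer r).map (RubikCube.cubeMachine c₁ c₂).outputAlphabet.symm =
        RubikCube.encodeAnswer r := List.map_id _
    rw [e1, e2]
    exact h
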